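/- Write $\mathbb{R}^+=[0,\infty)$. Let $\Gamma=\bigcup_{\gamma\in\mathcal{E}}\gamma([0,|\gamma|])\subset\mathbb{R}^N$ be an embedded network: $\mathcal{E}$ is a finite or countable family of $C^1$ simple oriented curves (arcs) $\gamma\colon[0,|\gamma|]\to\mathbb{R}^N$ with $|\dot\gamma|\equiv 1$ (loops $\gamma(0)=\gamma(|\gamma|)$ are allowed), containing with each $\gamma$ its inverse arc $\widetilde\gamma(s)=\gamma(|\gamma|-s)$, such that $\gamma((0,|\gamma|))\cap\gamma'([0,|\gamma'|])=\emptyset$ whenever $\gamma'\neq\gamma,\widetilde\gamma$; $\inf_{\gamma}|\gamma|>0$; for every vertex $x$ (endpoint of an arc; $\mathbf{V}$ is the set of vertices) the set $\mathcal{E}_x=\{\gamma\in\mathcal{E}:\gamma(0)=x\}$ is finite; and any two vertices are linked by a finite concatenation of arcs. Let $d_\Gamma$ be the geodesic distance on $\Gamma$, i.e. the infimum of the Euclidean lengths of the curves in $\Gamma$ linking two points. Let $H_\gamma\colon[0,|\gamma|]\times\mathbb{R}^+\times\mathbb{R}\to\mathbb{R}$, $\gamma\in\mathcal{E}$, satisfy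 $H_{\widetilde\gamma}(s,t,\mu)=H_\gamma(|\gamma|-s,t,-\mu)$ and: 1. each $H_\gamma$ is continuous, and convex in $\mu$; 2. for every $T>0$ there are nondecreasing, convex functions $\vartheta_T,\Theta_T\colon\mathbb{R}^+\to\mathbb{R}$ with $\vartheta_T(r)/r\to\infty$ and $\Theta_T(r)/r\to\infty$ as $r\to\infty$, such that $\vartheta_T(|\mu|)\le H_\gamma(s,t,\mu)\le\Theta_T(|\mu|)$ for all $\gamma\in\mathcal{E}$, $s\in[0,|\gamma|]$, $t\in[0,T]$, $\mu\in\mathbb{R}$; 3. for every $T>0$ there are $\alpha_T,\beta_T\ge0$ and $\epsilon_T\in(0,T]$ such that $$H_\gamma(s,t_1,\mu)-H_\gamma(s,t_2,\mu)\le\Big(\alpha_T\frac{H_\gamma(s,t_2,\mu)}{1+|\mu|}+\beta_T\Big)|t_2-t_1|$$ for all $\gamma\in\mathcal{E}$, $s\in[0,|\gamma|]$, $\mu\in\mathbb{R}$ and $t_1,t_2\in[0,T]$ with $|t_2-t_1|<\epsilon_T$. Put $L_\gamma(s,\lambda,t)=\max_{\mu\in\mathbb{R}}\{\lambda\mu-H_\gamma(s,t,\mu)\}$.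 Let $c_x\colon\mathbb{R}^+\to\mathbb{R}$, $x\in\mathbf{V}$, be a flux limiter: each $c_x$ is continuous with $c_x(t)\le\min_{\gamma\in\mathcal{E}_x}L_\gamma(0,0,t)$ for all $t\ge0$, and for every $T>0$ the functions $c_x$ are bounded on $[0,T]$ uniformly in $x\in\mathbf{V}$, and there are $\beta\ge0$, $\epsilon\in(0,T]$ with $c_x(t_1)-c_x(t_2)\le\beta|t_2-t_1|$ for all $x\in\mathbf{V}$ and $t_1,t_2\in[0,T]$ with $|t_2-t_1|<\epsilon$. Define $L(x,q,t)=\tfrac12|q|^2+c_x(t)$ if $x\in\mathbf{V}$, and $L(x,q,t)=L_\gamma(s,q\cdot\dot\gamma(s),t)$ if $x=\gamma(s)$ with $\gamma\in\mathcal{E}$, $s\in(0,|\gamma|)$. For $x_1,x_2\in\Gamma$ and $t_2\ge t_1\ge0$ let the minimal action be $$\Phi(x_1,t_1,x_2,t_2)=\inf\int_{t_1}^{t_2}L(\xi,\dot\xi,\tau)\,d\tau,$$ the infimum being taken over the absolutely continuous curves $\xi\colon[t_1,t_2]\to\Gamma$ with $\xi(t_1)=x_1$, $\xi(t_2)=x_2$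 (and $\Phi=\infty$ if $t_1=t_2$, $x_1\ne x_2$). Then, for all $T>0$ and $C>0$, $\Phi$ is finite and Lipschitz continuous on $$A_C=\{(x_1,t_1,x_2,t_2)\in(\Gamma\times[0,T])^2:\ d_\Gamma(x_1,x_2)\le C(t_2-t_1)\},$$ that is, there is a constant $K$ such that for all $(x_1,t_1,x_2,t_2),(x_1',t_1',x_2',t_2')\in A_C$ $$|\Phi(x_1,t_1,x_2,t_2)-\Phi(x_1',t_1',x_2',t_2')|\le K\big(d_\Gamma(x_1,x_1')+|t_1-t_1'|+d_\Gamma(x_2,x_2')+|t_2-t_2'|\big).$$ -/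

import Mathlib

open Set Filter Topology MeasureTheory

noncomputable section

/-- An embedded network in `ℝ^N`: a countable family of regular simple oriented arcs,
parametrised by arc length (loops, `γ(0) = γ(|γ|)`, are allowed), which contains with every arc
its inverse arc, whose arcs meet only at vertices, which is connected and locally finite, and
whose arcs have lengths bounded away from zero. The values of `arc i` outside
`[0, length i]` are irrelevant. -/
structure EmbeddedNetwork (N : ℕ) (ι : Type*) where
  /-- the Euclidean length of an arc -/
  length : ι → ℝ
  /-- the arc-length parametrisation of an arc, on `[0, length i]` -/
  arc : ι → ℝ → EuclideanSpace ℝ (Fin N)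
  /-- the index of the inverse arc -/
  rev : ι → ι
  countable : Countable ι
  length_pos : ∀ i, 0 < length i
  contDiffOn : ∀ i, ContDiffOn ℝ 1 (arc i) (Icc 0 (length i))
  unit_speed : ∀ i, ∀ s ∈ Icc 0 (length i), ‖derivWithin (arc i) (Icc 0 (length i)) s‖ = 1
  /-- simplicity: injective, except that the two endpoints may coincide -/
  injOn_Ico : ∀ i, InjOn (arc i) (Ico 0 (length i))
  injOn_Ioc : ∀ i, InjOn (arc i) (Ioc 0 (length i))
  length_rev : ∀ i, length (rev i) = length i
  arc_rev : ∀ i, ∀ s ∈ Icc 0 (length i), arc (rev i) s = arc i (length i - s)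
  /-- the interior of an arc does not meet any arc other than itself and its inverse -/
  disjoint : ∀ i j, j ≠ i → j ≠ rev i →
    Disjoint (arc i '' Ioo 0 (length i)) (arc j '' Icc 0 (length j))
  /-- any two endpoints of arcs are linked by a finite concatenation of arcs -/
  connected : ∀ i j, Relation.ReflTransGen
    (fun x y => ∃ k, arc k 0 = x ∧ arc k (length k) = y) (arc i 0) (arc j 0)
  exists_length_bound : ∃ δ > 0, ∀ i, δ ≤ length i
  locally_finite : ∀ x, {i | arc i 0 = x}.Finite

namespace EmbeddedNetwork

variable {N : ℕ} {ι : Type*} (Γ : EmbeddedNetwork N ι)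

/-- The network as a subset of `ℝ^N`. -/
def support : Set (EuclideanSpace ℝ (Fin N)) :=
  ⋃ i, Γ.arc i '' Icc 0 (Γ.length i)

/-- The set of vertices: all initial and terminal points of the arcs. -/
def vertices : Set (EuclideanSpace ℝ (Fin N)) :=
  {x | ∃ i, Γ.arc i 0 = x ∨ Γ.arc i (Γ.length i) = x}

/-- The tangent vector `γ̇(s)` (one-sided at the endpoints). -/
def tangent (i : ι) (s : ℝ) : EuclideanSpace ℝ (Fin N) :=
  derivWithin (Γ.arc i) (Icc 0 (Γ.length i)) s

/-- `ξ` restricts to an (absolutely continuous) curve `[t₁, t₂] → Γ`. -/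
structure IsCurve (ξ : ℝ → EuclideanSpace ℝ (Fin N)) (t₁ t₂ : ℝ) : Prop where
  le : t₁ ≤ t₂
  absolutelyContinuous : AbsolutelyContinuousOnInterval ξ t₁ t₂
  mem_support : ∀ t ∈ Icc t₁ t₂, ξ t ∈ Γ.support

/-- The geodesic distance on the network: the infimum of the Euclidean lengths of the curves in
`Γ` which link `x` to `y`, as an extended number. (Every rectifiable curve is absolutely continuous
once parametrised proportionally to arc length.) -/
def geodesicEDist (x y : EuclideanSpace ℝ (Fin N)) : ENNReal :=
  ⨅ (ξ : ℝ → EuclideanSpace ℝ (Fin N)) (_ : Γ.IsCurve ξ 0 1 ∧ ξ 0 = x ∧ ξ 1 = y),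
    eVariationOn ξ (Icc 0 1)

/-- The geodesic distance `d_Γ` as a real number; on a connected network the infimum
`geodesicEDist` is finite for points of `Γ`. -/
def geodesicDist (x y : EuclideanSpace ℝ (Fin N)) : ℝ :=
  (Γ.geodesicEDist x y).toReal

/-- A Hamiltonian `H i s t μ` on the network, with `s ∈ [0, length i]`, `t ≥ 0`, `μ ∈ ℝ`,
under the standing assumptions. -/
structure IsHamiltonian (H : ι → ℝ → ℝ → ℝ → ℝ) : Prop where
  compat : ∀ i, ∀ s ∈ Icc 0 (Γ.length i), ∀ t, 0 ≤ t → ∀ μ,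
    H (Γ.rev i) s t μ = H i (Γ.length i - s) t (-μ)
  continuousOn : ∀ i, ContinuousOn (fun p : ℝ × ℝ × ℝ => H i p.1 p.2.1 p.2.2)
    (Icc 0 (Γ.length i) ×ˢ Ici 0 ×ˢ univ)
  convex : ∀ i, ∀ s ∈ Icc 0 (Γ.length i), ∀ t, 0 ≤ t → ConvexOn ℝ univ (H i s t)
  coercive : ∀ T, 0 < T → ∃ θ Θ : ℝ → ℝ,
    (MonotoneOn θ (Ici 0) ∧ ConvexOn ℝ (Ici 0) θ ∧ Tendsto (fun r => θ r / r) atTop atTop) ∧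
    (MonotoneOn Θ (Ici 0) ∧ ConvexOn ℝ (Ici 0) Θ ∧ Tendsto (fun r => Θ r / r) atTop atTop) ∧
    ∀ i, ∀ s ∈ Icc 0 (Γ.length i), ∀ t ∈ Icc 0 T, ∀ μ,
      θ |μ| ≤ H i s t μ ∧ H i s t μ ≤ Θ |μ|
  time_lipschitz : ∀ T, 0 < T → ∃ α β ε : ℝ, 0 ≤ α ∧ 0 ≤ β ∧ 0 < ε ∧ ε ≤ T ∧
    ∀ i, ∀ s ∈ Icc 0 (Γ.length i), ∀ μ, ∀ t₁ ∈ Icc 0 T, ∀ t₂ ∈ Icc 0 T, |t₂ - t₁| < ε →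
      H i s t₁ μ - H i s t₂ μ ≤ (α * (H i s t₂ μ / (1 + |μ|)) + β) * |t₂ - t₁|

/-- The Lagrangian `L_γ(s, λ, t) = max_μ (λ μ - H_γ(s, t, μ))` on an arc. -/
def arcLagrangian (H : ι → ℝ → ℝ → ℝ → ℝ) (i : ι) (s v t : ℝ) : ℝ :=
  ⨆ μ : ℝ, (v * μ - H i s t μ)

/-- A flux limiter `c x t` (`x` a vertex, `t ≥ 0`) under the standing assumptions. -/
structure IsFluxLimiter (H : ι → ℝ → ℝ → ℝ → ℝ)
    (c : EuclideanSpace ℝ (Fin N) → ℝ → ℝ) : Prop where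
  continuousOn : ∀ x ∈ Γ.vertices, ContinuousOn (c x) (Ici 0)
  /-- `c x t` is at most the minimum of `L_γ(0, 0, t)` over the arcs `γ` starting at `x` -/
  le_arcLagrangian : ∀ x ∈ Γ.vertices, ∀ t, 0 ≤ t → ∀ i, Γ.arc i 0 = x →
    c x t ≤ arcLagrangian H i 0 0 t
  bounded : ∀ T, 0 < T → ∃ B : ℝ, ∀ x ∈ Γ.vertices, ∀ t ∈ Icc 0 T, |c x t| ≤ B
  time_lipschitz : ∀ T, 0 < T → ∃ β ε : ℝ, 0 ≤ β ∧ 0 < ε ∧ ε ≤ T ∧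
    ∀ x ∈ Γ.vertices, ∀ t₁ ∈ Icc 0 T, ∀ t₂ ∈ Icc 0 T, |t₂ - t₁| < ε →
      c x t₁ - c x t₂ ≤ β * |t₂ - t₁|

open Classical in
/-- The overall Lagrangian: `|q|²/2 + c_x(t)` at a vertex, and `L_γ(s, q · γ̇(s), t)` at an interior
point `x = γ(s)` of an arc. The choice of `γ` (up to inversion) does not matter by
`IsHamiltonian.compat`; the value for `x ∉ Γ` is irrelevant. -/
def lagrangian (H : ι → ℝ → ℝ → ℝ → ℝ) (c : EuclideanSpace ℝ (Fin N) → ℝ → ℝ)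
    (x q : EuclideanSpace ℝ (Fin N)) (t : ℝ) : ℝ :=
  if x ∈ Γ.vertices then ‖q‖ ^ 2 / 2 + c x t
  else if h : ∃ p : ι × ℝ, p.2 ∈ Ioo 0 (Γ.length p.1) ∧ Γ.arc p.1 p.2 = x then
    arcLagrangian H h.choose.1 h.choose.2
      (inner ℝ q (Γ.tangent h.choose.1 h.choose.2)) t
  else 0

/-- The action `∫ L(ξ, ξ̇, τ) dτ` over `[t₁, t₂]`, with value `⊤` when the positive part is not
integrable (the negative part always is, as `L` is bounded below on bounded time intervals). -/
def action (H : ι → ℝ → ℝ → ℝ → ℝ) (c : EuclideanSpace ℝ (Fin N) → ℝ → ℝ)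
    (ξ : ℝ → EuclideanSpace ℝ (Fin N)) (t₁ t₂ : ℝ) : EReal :=
  ((∫⁻ τ in Icc t₁ t₂, ENNReal.ofReal (Γ.lagrangian H c (ξ τ) (deriv ξ τ) τ) : ENNReal) : EReal)
    - ((∫⁻ τ in Icc t₁ t₂, ENNReal.ofReal (-Γ.lagrangian H c (ξ τ) (deriv ξ τ) τ) : ENNReal) :
        EReal)

/-- The minimal action functional `Φ(x₁, t₁, x₂, t₂)`; in particular it is `⊤` when no curve exists,
e.g. when `t₁ = t₂` and `x₁ ≠ x₂`. -/
def minAction (H : ι → ℝ → ℝ → ℝ → ℝ) (c : EuclideanSpace ℝ (Fin N) → ℝ → ℝ)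
    (x₁ : EuclideanSpace ℝ (Fin N)) (t₁ : ℝ) (x₂ : EuclideanSpace ℝ (Fin N)) (t₂ : ℝ) : EReal :=
  ⨅ (ξ : ℝ → EuclideanSpace ℝ (Fin N)) (_ : Γ.IsCurve ξ t₁ t₂ ∧ ξ t₁ = x₁ ∧ ξ t₂ = x₂),
    Γ.action H c ξ t₁ t₂

/-- The set `A_C` of the `(x₁, t₁, x₂, t₂) ∈ (Γ × [0, T])²` with `d_Γ(x₁, x₂) ≤ C (t₂ - t₁)`. -/
def admissibleSet (T C : ℝ) :
    Set (EuclideanSpace ℝ (Fin N) × ℝ × EuclideanSpace ℝ (Fin N) × ℝ) :=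
  {p | p.1 ∈ Γ.support ∧ p.2.1 ∈ Icc 0 T ∧ p.2.2.1 ∈ Γ.support ∧ p.2.2.2 ∈ Icc 0 T ∧
    Γ.geodesicDist p.1 p.2.2.1 ≤ C * (p.2.2.2 - p.2.1)}

end EmbeddedNetwork

end

/-! Let `h > 0` dominate the four displacements between two points of `A_C`. By symmetry it suffices
to turn any competitor `ξ` for the first point into a competitor for the second whose action is
larger by `O(h)`. The new curve goes from `y₁` to `x₁` during `[r₁, r₁ + h]`, follows `ξ` during
`[r₁ + h, r₂ - h]`, and goes from `x₂` to `y₂` during `[r₂ - h, r₂]`. The two end pieces have speed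
at most 2, so they cost `O(h)`.

The difficulty is the middle piece: `ξ` has to be traversed in a time shorter by some `d = O(h)`,
and since the Lagrangian may grow arbitrarily fast (no doubling condition), a uniform acceleration
could cost far too much where `ξ` is fast. Instead, `ξ` is accelerated only at times of moderate
speed. Linear motion between points of `A_C` has average shifted action at most some `M`, so `ξ` may
be assumed to have this property too. By Chebyshev's inequality the shifted Lagrangian is at most `2
M` on a set `E` of at least half the times, and coercivity bounds the speed there by `2 M`. On `E`
convexity between the velocities `q` and `2 q` makes the cost of the acceleration proportional to
the time gained. The shift in time costs at most `(α * speed + B)` times the shift, and the speed is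
integrable because it is bounded by the shifted Lagrangian. This is
`LagrangianBounds.exists_compressed`; the estimates on the Lagrangian behind it are gathered in
`exists_lagrangianBounds`.

If `t₂ - t₁` is not large compared with `h`, or `h` is not small, then `r₂ - r₁ = O(h)` and a curve
of bounded speed has action `O(h)`. The two cases are combined in
`LagrangianBounds.exists_perturbed`. Adding a constant `A` makes the Lagrangian nonnegative, so that
all estimates are made with lower integrals; returning to the action itself requires the Lagrangian
to be measurable along curves. -/

noncomputable section

/-! ### Absolutely continuous curves: change of parameter, concatenation, arc length. -/

open AbsolutelyContinuousOnInterval in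
theorem AbsolutelyContinuousOnInterval.comp_monotoneOn {X : Type*} [PseudoMetricSpace X]
    {f : ℝ → X} {φ : ℝ → ℝ} {a b c d : ℝ} {K : NNReal} (hab : a ≤ b) (hcd : c ≤ d)
    (hf : AbsolutelyContinuousOnInterval f c d) (hφ : MonotoneOn φ (Icc a b))
    (hK : LipschitzOnWith K φ (Icc a b)) (hm : MapsTo φ (Icc a b) (Icc c d)) :
    AbsolutelyContinuousOnInterval (fun t => f (φ t)) a b := by
  rw [absolutelyContinuousOnInterval_iff] at hf ⊢
  intro ε hε
  obtain ⟨δ, hδ, h⟩ := hf ε hε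
  have hK1 : (0 : ℝ) < K + 1 := by positivity
  refine ⟨δ / (K + 1), by positivity, fun E hE hsum => ?_⟩
  obtain ⟨hE1, hE2⟩ := hE
  rw [uIcc_of_le hab] at hE1
  refine h (E.1, fun i => (φ (E.2 i).1, φ (E.2 i).2)) ⟨?_, ?_⟩ ?_
  · rw [uIcc_of_le hcd]
    exact fun i hi => ⟨hm (hE1 i hi).1, hm (hE1 i hi).2⟩
  · intro i hi j hj hij
    have hij' := hE2 hi hj hij
    have hi' := hE1 i hi
    have hj' := hE1 j hj
    -- Disjointness of half-open intervals is an inequality between a minimum of right ends and a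
    -- maximum of left ends; a monotone `φ` commutes with `min` and `max`, so it preserves this
    -- inequality.
    simp only [Function.onFun, uIoc, Ioc_disjoint_Ioc] at hij' ⊢
    have mx : ∀ {u v : ℝ}, u ∈ Icc a b → v ∈ Icc a b → max u v ∈ Icc a b := fun {u v} hu hv => by
      rcases max_choice u v with h | h <;> rw [h] <;> assumption
    have mn : ∀ {u v : ℝ}, u ∈ Icc a b → v ∈ Icc a b → min u v ∈ Icc a b := fun {u v} hu hv => by
      rcases min_choice u v with h | h <;> rw [h] <;> assumption
    have e1 := mx hi'.1 hi'.2
    have e2 := mx hj'.1 hj'.2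
    have e3 := mn hi'.1 hi'.2
    have e4 := mn hj'.1 hj'.2
    rw [← hφ.map_max hi'.1 hi'.2, ← hφ.map_max hj'.1 hj'.2, ← hφ.map_min hi'.1 hi'.2,
      ← hφ.map_min hj'.1 hj'.2, ← hφ.map_min e1 e2, ← hφ.map_max e3 e4]
    exact hφ (mn e1 e2) (mx e3 e4) hij'
  · calc ∑ i ∈ Finset.range E.1, dist (φ (E.2 i).1) (φ (E.2 i).2)
        ≤ ∑ i ∈ Finset.range E.1, (K + 1) * dist (E.2 i).1 (E.2 i).2 := by
          refine Finset.sum_le_sum fun i hi => ?_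
          refine (hK.dist_le_mul _ (hE1 i hi).1 _ (hE1 i hi).2).trans ?_
          gcongr
          linarith
      _ = (K + 1) * ∑ i ∈ Finset.range E.1, dist (E.2 i).1 (E.2 i).2 := by
          rw [Finset.mul_sum]
      _ < (K + 1) * (δ / (K + 1)) := by gcongr
      _ = δ := by field_simp

open AbsolutelyContinuousOnInterval in
theorem AbsolutelyContinuousOnInterval.congr_on {X : Type*} [PseudoMetricSpace X]
    {f g : ℝ → X} {a b : ℝ} (hf : AbsolutelyContinuousOnInterval f a b)
    (h : EqOn f g (uIcc a b)) : AbsolutelyContinuousOnInterval g a b := by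
  rw [absolutelyContinuousOnInterval_iff] at hf ⊢
  intro ε hε
  obtain ⟨δ, hδ, hf⟩ := hf ε hε
  refine ⟨δ, hδ, fun E hE hsum => ?_⟩
  convert hf E hE hsum using 1
  refine Finset.sum_congr rfl fun i hi => ?_
  rw [h (hE.1 i hi).1, h (hE.1 i hi).2]

/-- The curve `ξ₁` up to the time `b`, and `ξ₂` from then on. -/
def curveConcat {X : Type*} (ξ₁ ξ₂ : ℝ → X) (b t : ℝ) : X := if t ≤ b then ξ₁ t else ξ₂ t

theorem curveConcat_of_le {X : Type*} {ξ₁ ξ₂ : ℝ → X} {b t : ℝ} (h : t ≤ b) :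
    curveConcat ξ₁ ξ₂ b t = ξ₁ t := if_pos h

theorem curveConcat_of_ge {X : Type*} {ξ₁ ξ₂ : ℝ → X} {b t : ℝ} (hb : ξ₁ b = ξ₂ b)
    (h : b ≤ t) : curveConcat ξ₁ ξ₂ b t = ξ₂ t := by
  rcases h.eq_or_lt with rfl | h
  · rw [curveConcat_of_le le_rfl, hb]
  · exact if_neg h.not_ge

/-- The concatenation equals `ξ₁ (min t b) + ξ₂ (max t b) - ξ₂ b`, a combination of absolutely
continuous curves on the whole interval. -/
theorem AbsolutelyContinuousOnInterval.concat {E : Type*} [NormedAddCommGroup E]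
    {ξ₁ ξ₂ : ℝ → E} {a b c : ℝ} (hab : a ≤ b) (hbc : b ≤ c)
    (h₁ : AbsolutelyContinuousOnInterval ξ₁ a b) (h₂ : AbsolutelyContinuousOnInterval ξ₂ b c)
    (hb : ξ₁ b = ξ₂ b) : AbsolutelyContinuousOnInterval (curveConcat ξ₁ ξ₂ b) a c := by
  have hac := hab.trans hbc
  have e₁ : AbsolutelyContinuousOnInterval (fun t => ξ₁ (min t b)) a c :=
    h₁.comp_monotoneOn (K := 1) hac hab (fun x _ y _ hxy => min_le_min_right _ hxy)
      (LipschitzWith.id.min_const b).lipschitzOnWith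
      (fun t ht => ⟨le_min ht.1 hab, min_le_right _ _⟩)
  have e₂ : AbsolutelyContinuousOnInterval (fun t => ξ₂ (max t b)) a c :=
    h₂.comp_monotoneOn (K := 1) hac hbc (fun x _ y _ hxy => max_le_max_right _ hxy)
      (LipschitzWith.id.max_const b).lipschitzOnWith
      (fun t ht => ⟨le_max_right _ _, max_le ht.2 hbc⟩)
  have e₃ : AbsolutelyContinuousOnInterval (fun _ => ξ₂ b) a c :=
    ((LipschitzWith.const (ξ₂ b)).lipschitzOnWith
      (s := uIcc a c)).absolutelyContinuousOnInterval
  refine ((e₁.add e₂).sub e₃).congr_on fun t _ => ?_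
  rcases le_total t b with h | h
  · simp [curveConcat_of_le h, h]
  · simp [curveConcat_of_ge hb h, h, hb]

theorem deriv_curveConcat_of_lt {E : Type*} [NormedAddCommGroup E] [NormedSpace ℝ E]
    {ξ₁ ξ₂ : ℝ → E} {b t : ℝ} (h : t < b) : deriv (curveConcat ξ₁ ξ₂ b) t = deriv ξ₁ t :=
  Filter.EventuallyEq.deriv_eq <| by
    filter_upwards [Iio_mem_nhds h] with s hs using curveConcat_of_le (le_of_lt hs)

theorem deriv_curveConcat_of_gt {E : Type*} [NormedAddCommGroup E] [NormedSpace ℝ E]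
    {ξ₁ ξ₂ : ℝ → E} {b t : ℝ} (h : b < t) : deriv (curveConcat ξ₁ ξ₂ b) t = deriv ξ₂ t :=
  Filter.EventuallyEq.deriv_eq <| by
    filter_upwards [Ioi_mem_nhds h] with s hs using if_neg (not_le.2 hs)

/-- The one-sided jumps of the variation function are those of `f`, which vanish. -/
theorem LocallyBoundedVariationOn.continuousOn_variationOnFromTo {X : Type*} [PseudoMetricSpace X]
    {f : ℝ → X} {s : Set ℝ} (hf : LocallyBoundedVariationOn f s) (hc : ContinuousOn f s) {a : ℝ}
    (ha : a ∈ s) : ContinuousOn (variationOnFromTo f s a) s := by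
  intro b hb
  have hl := variationOnFromTo.tendsto_left ha hb hf ((hc b hb).mono inter_subset_left)
  have hr := variationOnFromTo.tendsto_right ha hb hf ((hc b hb).mono inter_subset_left)
  rw [dist_self, sub_zero] at hl
  rw [dist_self, add_zero] at hr
  have h1 : ContinuousWithinAt (variationOnFromTo f s a) (s ∩ Iio b ∪ {b} ∪ s ∩ Ioi b) b :=
    (ContinuousWithinAt.union hl continuousWithinAt_singleton).union hr
  refine h1.mono fun x hx => ?_
  rcases lt_trichotomy x b with h | h | h
  · exact Or.inl (Or.inl ⟨hx, h⟩)
  · exact Or.inl (Or.inr h)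
  · exact Or.inr ⟨hx, h⟩

/-- Reparametrisation of an absolutely continuous curve proportionally to arc length. -/
theorem AbsolutelyContinuousOnInterval.exists_lipschitzOnWith {X : Type*} [NormedAddCommGroup X]
    {f : ℝ → X} (hf : AbsolutelyContinuousOnInterval f 0 1) :
    ∃ g : ℝ → X, LipschitzOnWith (eVariationOn f (Icc 0 1)).toNNReal g (Icc 0 1) ∧
      MapsTo g (Icc 0 1) (f '' Icc 0 1) ∧ g 0 = f 0 ∧ g 1 = f 1 := by
  have h01 : (0 : ℝ) ∈ Icc (0 : ℝ) 1 := by simp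
  have h11 : (1 : ℝ) ∈ Icc (0 : ℝ) 1 := by simp
  have hbv : BoundedVariationOn f (Icc 0 1) := by
    have := hf.boundedVariationOn
    rwa [uIcc_of_le zero_le_one] at this
  have hl := hbv.locallyBoundedVariationOn
  have hc : ContinuousOn f (Icc 0 1) := by
    have := hf.continuousOn
    rwa [uIcc_of_le zero_le_one] at this
  obtain ⟨v, hv⟩ : ∃ v, v = variationOnFromTo f (Icc 0 1) 0 := ⟨_, rfl⟩
  obtain ⟨ℓ, hℓ⟩ : ∃ ℓ, ℓ = (eVariationOn f (Icc 0 1)).toNNReal := ⟨_, rfl⟩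
  have hv0 : v 0 = 0 := by
    rw [hv]
    exact variationOnFromTo.self _ _ _
  have hv1 : v 1 = ℓ := by
    rw [hv, variationOnFromTo.eq_of_le _ _ zero_le_one, inter_self, hℓ]
    exact (ENNReal.coe_toNNReal_eq_toReal _).symm
  -- The natural parametrisation is controlled only on the range of `v`; continuity of `v` ensures
  -- that this range leaves no gap in `[0, ℓ]`.
  have himg : Icc (0 : ℝ) ℓ ⊆ v '' Icc 0 1 := by
    have := intermediate_value_Icc zero_le_one (hl.continuousOn_variationOnFromTo hc h01)
    rwa [← hv, hv0, hv1] at this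
  have hus := has_unit_speed_naturalParameterization f hl h01
  have hnat : ∀ t ∈ Icc (0 : ℝ) 1, naturalParameterization f (Icc 0 1) 0 (v t) = f t :=
    fun t ht => hv ▸ edist_eq_zero.1 (edist_naturalParameterization_eq_zero hl h01 ht)
  rw [← hv] at hus
  generalize naturalParameterization f (Icc 0 1) 0 = η at hus hnat
  have hηl : ∀ x ∈ Icc (0 : ℝ) ℓ, ∀ y ∈ Icc (0 : ℝ) ℓ, x ≤ y →
      edist (η x) (η y) ≤ ENNReal.ofReal (y - x) := by
    intro x hx y hy hxy
    have h := hus (himg hx) (himg hy)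
    rw [NNReal.coe_one, one_mul] at h
    rw [← h]
    exact eVariationOn.edist_le _ ⟨himg hx, le_rfl, hxy⟩ ⟨himg hy, hxy, le_rfl⟩
  have hsc : ∀ t ∈ Icc (0 : ℝ) 1, (ℓ : ℝ) * t ∈ Icc (0 : ℝ) ℓ := fun t ht =>
    ⟨mul_nonneg ℓ.2 ht.1, mul_le_of_le_one_right ℓ.2 ht.2⟩
  rw [← hℓ]
  refine ⟨fun t => η (ℓ * t), ?_, ?_, ?_, ?_⟩
  · have key : ∀ x ∈ Icc (0 : ℝ) 1, ∀ y ∈ Icc (0 : ℝ) 1, x ≤ y →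
        edist (η (ℓ * x)) (η (ℓ * y)) ≤ ℓ * edist x y := by
      intro x hx y hy hxy
      refine (hηl _ (hsc x hx) _ (hsc y hy) (by gcongr)).trans_eq ?_
      rw [edist_dist, dist_comm, Real.dist_eq, abs_of_nonneg (sub_nonneg.2 hxy), ← mul_sub,
        ENNReal.ofReal_mul ℓ.coe_nonneg, ENNReal.ofReal_coe_nnreal]
    intro x hx y hy
    rcases le_total x y with h | h
    · exact key x hx y hy h
    · rw [edist_comm, edist_comm x]
      exact key y hy x hx h
  · intro t ht
    obtain ⟨u, hu, hut⟩ := himg (hsc t ht)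
    exact ⟨u, hu, by simp only [← hut, hnat u hu]⟩
  · simp only [mul_zero]
    rw [← hv0, hnat 0 h01, hv0]
  · simp only [mul_one]
    rw [← hv1, hnat 1 h11]

/-! ### Curves in the network and the geodesic distance. -/

namespace EmbeddedNetwork

variable {N : ℕ} {ι : Type*} (Γ : EmbeddedNetwork N ι)

variable {Γ} in
theorem IsCurve.concat {ξ₁ ξ₂ : ℝ → EuclideanSpace ℝ (Fin N)} {a b c : ℝ}
    (h₁ : Γ.IsCurve ξ₁ a b) (h₂ : Γ.IsCurve ξ₂ b c) (hb : ξ₁ b = ξ₂ b) :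
    Γ.IsCurve (curveConcat ξ₁ ξ₂ b) a c where
  le := h₁.le.trans h₂.le
  absolutelyContinuous := h₁.absolutelyContinuous.concat h₁.le h₂.le h₂.absolutelyContinuous hb
  mem_support t ht := by
    rcases le_total t b with h | h
    · rw [curveConcat_of_le h]
      exact h₁.mem_support t ⟨ht.1, h⟩
    · rw [curveConcat_of_ge hb h]
      exact h₂.mem_support t ⟨h, ht.2⟩

variable {Γ} in
theorem IsCurve.comp_monotoneOn {ξ : ℝ → EuclideanSpace ℝ (Fin N)} {φ : ℝ → ℝ} {a b c d : ℝ}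
    {K : NNReal} (h : Γ.IsCurve ξ c d) (hab : a ≤ b) (hφ : MonotoneOn φ (Icc a b))
    (hK : LipschitzOnWith K φ (Icc a b)) (hm : MapsTo φ (Icc a b) (Icc c d)) :
    Γ.IsCurve (fun t => ξ (φ t)) a b where
  le := hab
  absolutelyContinuous := h.absolutelyContinuous.comp_monotoneOn hab h.le hφ hK hm
  mem_support _ ht := h.mem_support _ (hm ht)

variable {Γ} in
theorem IsCurve.continuousOn {ξ : ℝ → EuclideanSpace ℝ (Fin N)} {a b : ℝ}
    (h : Γ.IsCurve ξ a b) : ContinuousOn ξ (Icc a b) := by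
  have := h.absolutelyContinuous.continuousOn
  rwa [uIcc_of_le h.le] at this

theorem isCurve_of_lipschitzOnWith {ξ : ℝ → EuclideanSpace ℝ (Fin N)} {a b : ℝ} {K : NNReal}
    (hab : a ≤ b) (h : LipschitzOnWith K ξ (Icc a b)) (hm : MapsTo ξ (Icc a b) Γ.support) :
    Γ.IsCurve ξ a b where
  le := hab
  absolutelyContinuous := by
    refine LipschitzOnWith.absolutelyContinuousOnInterval (K := K) ?_
    rwa [uIcc_of_le hab]
  mem_support _ ht := hm ht

theorem arc_mem_support (i : ι) {s : ℝ} (hs : s ∈ Icc 0 (Γ.length i)) :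
    Γ.arc i s ∈ Γ.support := mem_iUnion.2 ⟨i, s, hs, rfl⟩

theorem lipschitzOnWith_arc (i : ι) : LipschitzOnWith 1 (Γ.arc i) (Icc 0 (Γ.length i)) := by
  refine Convex.lipschitzOnWith_of_nnnorm_derivWithin_le (𝕜 := ℝ) (convex_Icc _ _)
    ((Γ.contDiffOn i).differentiableOn one_ne_zero) fun s hs => ?_
  rw [← NNReal.coe_le_coe, coe_nnnorm, Γ.unit_speed i s hs]
  rfl

/-- `x` and `y` are joined by a curve in the network. -/
def Linked (x y : EuclideanSpace ℝ (Fin N)) : Prop :=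
  ∃ ξ a b, Γ.IsCurve ξ a b ∧ ξ a = x ∧ ξ b = y

variable {Γ} in
theorem Linked.trans {x y z : EuclideanSpace ℝ (Fin N)} (h₁ : Γ.Linked x y)
    (h₂ : Γ.Linked y z) : Γ.Linked x z := by
  obtain ⟨ξ₁, a, b, hξ₁, rfl, rfl⟩ := h₁
  obtain ⟨ξ₂, c, d, hξ₂, hc, rfl⟩ := h₂
  have h₂' : Γ.IsCurve (fun t => ξ₂ (t - b + c)) b (b + (d - c)) := by
    refine hξ₂.comp_monotoneOn (K := 1) (by linarith [hξ₂.le]) (fun x _ y _ h => by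
      simpa using h) (LipschitzWith.of_dist_le_mul fun x y => ?_).lipschitzOnWith ?_
    · simp
    · intro t ht
      constructor <;> linarith [ht.1, ht.2]
  have hb : ξ₁ b = (fun t => ξ₂ (t - b + c)) b := by simp [hc]
  refine ⟨_, _, _, hξ₁.concat h₂' hb, curveConcat_of_le hξ₁.le, ?_⟩
  rw [curveConcat_of_ge hb h₂'.le]
  congr 1
  ring

theorem linked_arc_arc (i : ι) {s t : ℝ} (hs : s ∈ Icc 0 (Γ.length i))
    (ht : t ∈ Icc 0 (Γ.length i)) : Γ.Linked (Γ.arc i s) (Γ.arc i t) := by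
  have key : ∀ j, ∀ s ∈ Icc 0 (Γ.length j), ∀ t ∈ Icc 0 (Γ.length j), s ≤ t →
      Γ.Linked (Γ.arc j s) (Γ.arc j t) := fun j s hs t ht hst =>
    ⟨Γ.arc j, s, t, Γ.isCurve_of_lipschitzOnWith hst
      ((Γ.lipschitzOnWith_arc j).mono (Icc_subset_Icc hs.1 ht.2))
      fun u hu => Γ.arc_mem_support j ⟨hs.1.trans hu.1, hu.2.trans ht.2⟩, rfl, rfl⟩
  rcases le_total s t with h | h
  · exact key i s hs t ht h
  · have hs' : Γ.length i - s ∈ Icc 0 (Γ.length (Γ.rev i)) := by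
      rw [Γ.length_rev]
      constructor <;> linarith [hs.1, hs.2]
    have ht' : Γ.length i - t ∈ Icc 0 (Γ.length (Γ.rev i)) := by
      rw [Γ.length_rev]
      constructor <;> linarith [ht.1, ht.2]
    have := key (Γ.rev i) _ hs' _ ht' (by linarith)
    rw [Γ.length_rev] at hs' ht'
    rwa [Γ.arc_rev i _ hs', Γ.arc_rev i _ ht', sub_sub_cancel, sub_sub_cancel] at this

theorem linked_of_mem_support {x y : EuclideanSpace ℝ (Fin N)} (hx : x ∈ Γ.support)
    (hy : y ∈ Γ.support) : Γ.Linked x y := by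
  obtain ⟨i, s, hs, rfl⟩ := mem_iUnion.1 hx
  obtain ⟨j, t, ht, rfl⟩ := mem_iUnion.1 hy
  have h0 : ∀ k, (0 : ℝ) ∈ Icc 0 (Γ.length k) := fun k => ⟨le_rfl, (Γ.length_pos k).le⟩
  have h1 : ∀ k, Γ.length k ∈ Icc 0 (Γ.length k) := fun k => ⟨(Γ.length_pos k).le, le_rfl⟩
  refine ((Γ.linked_arc_arc i hs (h0 i)).trans ?_).trans (Γ.linked_arc_arc j (h0 j) ht)
  have key : ∀ z, Relation.ReflTransGen
      (fun x y => ∃ k, Γ.arc k 0 = x ∧ Γ.arc k (Γ.length k) = y) (Γ.arc i 0) z →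
      Γ.Linked (Γ.arc i 0) z := by
    intro z hz
    induction hz with
    | refl => exact Γ.linked_arc_arc i (h0 i) (h0 i)
    | tail _ h ih =>
      obtain ⟨k, rfl, rfl⟩ := h
      exact ih.trans (Γ.linked_arc_arc k (h0 k) (h1 k))
  exact key _ (Γ.connected i j)

/-- Without finiteness `geodesicDist` would be meaningless, as `toReal` sends `⊤` to 0. -/
theorem geodesicEDist_ne_top {x y : EuclideanSpace ℝ (Fin N)} (hx : x ∈ Γ.support)
    (hy : y ∈ Γ.support) : Γ.geodesicEDist x y ≠ ⊤ := by
  obtain ⟨ξ, a, b, hξ, rfl, rfl⟩ := Γ.linked_of_mem_support hx hy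
  have hab := hξ.le
  have h : Γ.IsCurve (fun t => ξ (a + (b - a) * t)) 0 1 := by
    refine hξ.comp_monotoneOn (K := (b - a).toNNReal) zero_le_one (fun x _ y _ h => ?_)
      (LipschitzWith.of_dist_le_mul fun x y => ?_).lipschitzOnWith fun t ht => ?_
    · have : (b - a) * x ≤ (b - a) * y := mul_le_mul_of_nonneg_left h (by linarith)
      simpa using this
    · rw [Real.coe_toNNReal _ (by linarith), Real.dist_eq, Real.dist_eq,
        ← abs_of_nonneg (sub_nonneg.2 hab), ← abs_mul, abs_of_nonneg (sub_nonneg.2 hab)]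
      ring_nf
      rfl
    · constructor <;> nlinarith [ht.1, ht.2]
  have hbv := h.absolutelyContinuous.boundedVariationOn
  rw [uIcc_of_le zero_le_one] at hbv
  refine ne_top_of_le_ne_top hbv (iInf₂_le _ ⟨h, ?_, ?_⟩)
  · simp
  · simp

theorem geodesicDist_nonneg (x y : EuclideanSpace ℝ (Fin N)) : 0 ≤ Γ.geodesicDist x y :=
  ENNReal.toReal_nonneg

theorem eq_of_geodesicDist_le_zero {x y : EuclideanSpace ℝ (Fin N)} (hx : x ∈ Γ.support)
    (hy : y ∈ Γ.support) (h : Γ.geodesicDist x y ≤ 0) : x = y := by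
  have h0 : Γ.geodesicEDist x y = 0 :=
    ((ENNReal.toReal_eq_zero_iff _).1 (h.antisymm (Γ.geodesicDist_nonneg x y))).resolve_right
      (Γ.geodesicEDist_ne_top hx hy)
  refine edist_le_zero.1 (h0 ▸ le_iInf₂ fun ξ hξ => ?_)
  rw [← hξ.2.1, ← hξ.2.2]
  exact eVariationOn.edist_le _ (by simp) (by simp)

/-- A strict inequality is assumed so that no minimising curve is needed; parametrisation
proportional to arc length converts the bound on the length into a Lipschitz constant. -/
theorem exists_lipschitzOnWith_of_geodesicDist_lt {x y : EuclideanSpace ℝ (Fin N)}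
    (hx : x ∈ Γ.support) (hy : y ∈ Γ.support) {ℓ : NNReal} (h : Γ.geodesicDist x y < ℓ) :
    ∃ ζ : ℝ → EuclideanSpace ℝ (Fin N), LipschitzOnWith ℓ ζ (Icc 0 1) ∧
      MapsTo ζ (Icc 0 1) Γ.support ∧ ζ 0 = x ∧ ζ 1 = y := by
  have h' : Γ.geodesicEDist x y < ℓ := by
    rw [← ENNReal.ofReal_coe_nnreal]
    exact (ENNReal.lt_ofReal_iff_toReal_lt (Γ.geodesicEDist_ne_top hx hy)).2 h
  obtain ⟨ξ, h''⟩ := iInf_lt_iff.1 h'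
  obtain ⟨⟨hξ, rfl, rfl⟩, hlt⟩ := iInf_lt_iff.1 h''
  obtain ⟨g, hg, hm, h0, h1⟩ := hξ.absolutelyContinuous.exists_lipschitzOnWith
  refine ⟨g, hg.weaken ?_, fun t ht => ?_, h0, h1⟩
  · exact (ENNReal.toNNReal_mono ENNReal.coe_ne_top hlt.le).trans_eq (ENNReal.toNNReal_coe _)
  · obtain ⟨u, hu, e⟩ := hm ht
    rw [← e]
    exact hξ.mem_support u hu

theorem exists_isCurve_of_lipschitzOnWith {ζ : ℝ → EuclideanSpace ℝ (Fin N)} {ℓ : NNReal}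
    (hζ : LipschitzOnWith ℓ ζ (Icc 0 1)) (hm : MapsTo ζ (Icc 0 1) Γ.support) {a b : ℝ}
    (hab : a < b) : ∃ ξ, Γ.IsCurve ξ a b ∧ ξ a = ζ 0 ∧ ξ b = ζ 1 ∧
      ∀ t ∈ Ioo a b, ‖deriv ξ t‖ ≤ ℓ / (b - a) := by
  have hab' : 0 < b - a := sub_pos.2 hab
  have hmaps : MapsTo (fun t => (t - a) / (b - a)) (Icc a b) (Icc 0 1) := fun t ht =>
    ⟨div_nonneg (sub_nonneg.2 ht.1) hab'.le, (div_le_one hab').2 (by linarith [ht.2])⟩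
  have hφ : LipschitzWith (b - a)⁻¹.toNNReal (fun t => (t - a) / (b - a)) :=
    LipschitzWith.of_dist_le_mul fun x y => by
      rw [Real.coe_toNNReal _ (by positivity), Real.dist_eq, Real.dist_eq, ← sub_div,
        sub_sub_sub_cancel_right, abs_div, abs_of_pos hab', div_eq_inv_mul]
  have hξ : LipschitzOnWith (ℓ * (b - a)⁻¹.toNNReal) (fun t => ζ ((t - a) / (b - a))) (Icc a b) :=
    hζ.comp hφ.lipschitzOnWith hmaps
  refine ⟨fun t => ζ ((t - a) / (b - a)), Γ.isCurve_of_lipschitzOnWith hab.le hξ (hm.comp hmaps),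
    by simp, by simp [div_self hab'.ne'], fun t ht => ?_⟩
  refine (norm_deriv_le_of_lipschitzOn (Icc_mem_nhds ht.1 ht.2) hξ).trans_eq ?_
  rw [NNReal.coe_mul, Real.coe_toNNReal _ (by positivity), div_eq_mul_inv]

theorem exists_isCurve_norm_deriv_le {x y : EuclideanSpace ℝ (Fin N)}
    (hx : x ∈ Γ.support) (hy : y ∈ Γ.support) {a b ℓ : ℝ} (hab : a < b)
    (h : Γ.geodesicDist x y < ℓ * (b - a)) :
    ∃ ξ, Γ.IsCurve ξ a b ∧ ξ a = x ∧ ξ b = y ∧ ∀ t ∈ Ioo a b, ‖deriv ξ t‖ ≤ ℓ := by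
  have h0 := (Γ.geodesicDist_nonneg x y).trans_lt h
  lift ℓ * (b - a) to NNReal using h0.le with ℓ' hℓ'
  obtain ⟨ζ, hζ, hm, rfl, rfl⟩ := Γ.exists_lipschitzOnWith_of_geodesicDist_lt hx hy h
  obtain ⟨ξ, hξ, h0, h1, hd⟩ := Γ.exists_isCurve_of_lipschitzOnWith hζ hm hab
  refine ⟨ξ, hξ, h0, h1, fun t ht => (hd t ht).trans_eq ?_⟩
  rw [hℓ', mul_div_cancel_right₀ _ (sub_pos.2 hab).ne']

/-- Serves in place of the symmetry of `geodesicDist`: the connecting curve is run backwards. -/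
theorem exists_isCurve_norm_deriv_le_symm {x y : EuclideanSpace ℝ (Fin N)}
    (hx : x ∈ Γ.support) (hy : y ∈ Γ.support) {a b ℓ : ℝ} (hab : a < b)
    (h : Γ.geodesicDist x y < ℓ * (b - a)) :
    ∃ ξ, Γ.IsCurve ξ a b ∧ ξ a = y ∧ ξ b = x ∧ ∀ t ∈ Ioo a b, ‖deriv ξ t‖ ≤ ℓ := by
  have h0 := (Γ.geodesicDist_nonneg x y).trans_lt h
  lift ℓ * (b - a) to NNReal using h0.le with ℓ' hℓ'
  obtain ⟨ζ, hζ, hm, rfl, rfl⟩ := Γ.exists_lipschitzOnWith_of_geodesicDist_lt hx hy h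
  have hmaps : MapsTo (fun t : ℝ => 1 - t) (Icc 0 1) (Icc 0 1) := fun t ht =>
    ⟨by linarith [ht.2], by linarith [ht.1]⟩
  have hrev : LipschitzWith 1 (fun t : ℝ => 1 - t) :=
    LipschitzWith.of_dist_le_mul fun x y => by
      rw [dist_sub_left, NNReal.coe_one, one_mul]
  have hζ' := hζ.comp hrev.lipschitzOnWith hmaps
  rw [mul_one] at hζ'
  obtain ⟨ξ, hξ, h0, h1, hd⟩ :=
    Γ.exists_isCurve_of_lipschitzOnWith hζ' (hm.comp hmaps) hab
  refine ⟨ξ, hξ, by simpa using h0, by simpa using h1, fun t ht => (hd t ht).trans_eq ?_⟩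
  rw [hℓ', mul_div_cancel_right₀ _ (sub_pos.2 hab).ne']

end EmbeddedNetwork

/-! ### Growth, convexity and time regularity of the Lagrangian. -/

theorem exists_forall_mul_sub_le_of_superlinear {θ : ℝ → ℝ} (hm : MonotoneOn θ (Ici 0))
    (hs : Tendsto (fun r => θ r / r) atTop atTop) (R : ℝ) :
    ∃ M, ∀ r, 0 ≤ r → R * r - θ r ≤ M := by
  obtain ⟨r₀, hr₀⟩ := eventually_atTop.1 (hs.eventually_ge_atTop R)
  -- Beyond `r₀` the quotient `θ r / r` is at least `R`, so 0 is a bound; before it, monotonicity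
  -- gives `θ 0 ≤ θ r`.
  refine ⟨max 0 (|R| * max r₀ 1 - θ 0), fun r hr => ?_⟩
  rcases le_total (max r₀ 1) r with h | h
  · have hpos : 0 < r := lt_of_lt_of_le (by positivity) ((le_max_right r₀ 1).trans h)
    have := (le_div_iff₀ hpos).1 (hr₀ r ((le_max_left _ _).trans h))
    exact le_max_of_le_left (by linarith)
  · have h0 : θ 0 ≤ θ r := hm self_mem_Ici hr hr
    have h1 : R * r ≤ |R| * max r₀ 1 :=
      (mul_le_mul_of_nonneg_right (le_abs_self R) hr).trans
        (mul_le_mul_of_nonneg_left h (abs_nonneg R))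
    exact le_max_of_le_right (by linarith)

namespace EmbeddedNetwork

variable {N : ℕ} {ι : Type*} {H : ι → ℝ → ℝ → ℝ → ℝ}

section ArcLagrangian

variable {i : ι} {s t : ℝ}

theorem sub_le_of_superlinear {θ : ℝ → ℝ} {R M : ℝ} (hM : ∀ r, 0 ≤ r → R * r - θ r ≤ M)
    (hθ : ∀ μ, θ |μ| ≤ H i s t μ) {v : ℝ} (hv : |v| ≤ R) (μ : ℝ) : v * μ - H i s t μ ≤ M := by
  have h1 : v * μ ≤ R * |μ| := calc
    v * μ ≤ |v * μ| := le_abs_self _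
    _ = |v| * |μ| := abs_mul _ _
    _ ≤ R * |μ| := by gcongr
  linarith [hM |μ| (abs_nonneg μ), hθ μ]

theorem bddAbove_range_sub {θ : ℝ → ℝ} (hm : MonotoneOn θ (Ici 0))
    (hs : Tendsto (fun r => θ r / r) atTop atTop) (hθ : ∀ μ, θ |μ| ≤ H i s t μ) (v : ℝ) :
    BddAbove (range fun μ => v * μ - H i s t μ) := by
  obtain ⟨M, hM⟩ := exists_forall_mul_sub_le_of_superlinear hm hs |v|
  exact ⟨M, forall_mem_range.2 (sub_le_of_superlinear hM hθ le_rfl)⟩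

/-- Testing the supremum at `μ = ±1` gives linear growth, which is all the coercivity needed later.
-/
theorem abs_sub_le_arcLagrangian {Θ : ℝ → ℝ} {v : ℝ}
    (hb : BddAbove (range fun μ => v * μ - H i s t μ)) (hΘ : ∀ μ, H i s t μ ≤ Θ |μ|) :
    |v| - Θ 1 ≤ arcLagrangian H i s v t := by
  rcases le_total 0 v with h | h
  · refine le_trans ?_ (le_ciSup hb 1)
    have := hΘ 1
    rw [abs_one] at this
    simp only [abs_of_nonneg h, mul_one]
    linarith
  · refine le_trans ?_ (le_ciSup hb (-1))
    have := hΘ (-1)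
    rw [abs_neg, abs_one] at this
    simp only [abs_of_nonpos h, mul_neg, mul_one]
    linarith

/-- Convexity in the velocity, from `r v = (2 - r) v + (r - 1) (2 v)`. -/
theorem arcLagrangian_mul_le {v r : ℝ} (hr₁ : 1 ≤ r) (hr₂ : r ≤ 2)
    (hb : ∀ v, BddAbove (range fun μ => v * μ - H i s t μ)) :
    arcLagrangian H i s (r * v) t ≤
      (2 - r) * arcLagrangian H i s v t + (r - 1) * arcLagrangian H i s (2 * v) t := by
  refine ciSup_le fun μ => ?_
  have h1 : v * μ - H i s t μ ≤ arcLagrangian H i s v t := le_ciSup (hb v) μ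
  have h2 : 2 * v * μ - H i s t μ ≤ arcLagrangian H i s (2 * v) t := le_ciSup (hb (2 * v)) μ
  have h3 := mul_le_mul_of_nonneg_left h1 (sub_nonneg.2 hr₂)
  have h4 := mul_le_mul_of_nonneg_left h2 (sub_nonneg.2 hr₁)
  linarith

/-- Take an almost maximising `μ` at time `t'`. Comparison with `μ = 0` gives `H i s t' μ ≤ |v| |μ|
+ |Θ 0| + 1`, so the quotient `H / (1 + |μ|)` in the time regularity of `H` is bounded linearly in
`|v|`. -/
theorem arcLagrangian_le_add {Θ : ℝ → ℝ} {v t' α β : ℝ} (hα : 0 ≤ α)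
    (hb : BddAbove (range fun μ => v * μ - H i s t μ))
    (hb' : BddAbove (range fun μ => v * μ - H i s t' μ)) (hΘ' : ∀ μ, H i s t' μ ≤ Θ |μ|)
    (hlip : ∀ μ, H i s t μ - H i s t' μ ≤ (α * (H i s t' μ / (1 + |μ|)) + β) * |t' - t|) :
    arcLagrangian H i s v t' ≤ arcLagrangian H i s v t +
      (α * |v| + (α * (|Θ 0| + 1) + β)) * |t' - t| := by
  refine le_of_forall_pos_lt_add fun η hη => ?_
  obtain ⟨μ, hμ⟩ := exists_lt_of_lt_ciSup (f := fun μ => v * μ - H i s t' μ)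
    (show arcLagrangian H i s v t' - min η 1 < arcLagrangian H i s v t' by
      linarith [lt_min hη one_pos])
  have h0 : v * 0 - H i s t' 0 ≤ arcLagrangian H i s v t' := le_ciSup hb' 0
  have h00 := hΘ' 0
  rw [abs_zero] at h00
  have hμ1 : (0 : ℝ) < 1 + |μ| := by positivity
  have hH : H i s t' μ / (1 + |μ|) ≤ |v| + |Θ 0| + 1 := by
    rw [div_le_iff₀ hμ1]
    have h1 : v * μ ≤ |v| * |μ| := (le_abs_self _).trans_eq (abs_mul _ _)
    have h2 : H i s t' μ ≤ |v| * |μ| + |Θ 0| + 1 := by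
      linarith [min_le_right η 1, le_abs_self (Θ 0)]
    nlinarith [abs_nonneg v, abs_nonneg μ, abs_nonneg (Θ 0),
      mul_nonneg (abs_nonneg (Θ 0)) (abs_nonneg μ)]
  have h3 := hlip μ
  have h4 : (α * (H i s t' μ / (1 + |μ|)) + β) * |t' - t| ≤
      (α * (|v| + |Θ 0| + 1) + β) * |t' - t| := by gcongr
  have h5 : v * μ - H i s t μ ≤ arcLagrangian H i s v t := le_ciSup hb μ
  have h6 := min_le_left η 1
  linarith

end ArcLagrangian

variable (Γ : EmbeddedNetwork N ι)

open Classical in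
/-- The norm of the velocity `q` at a vertex, and that of its tangential part inside an arc. -/
def effectiveSpeed (x q : EuclideanSpace ℝ (Fin N)) : ℝ :=
  if x ∈ Γ.vertices then ‖q‖
  else if h : ∃ p : ι × ℝ, p.2 ∈ Ioo 0 (Γ.length p.1) ∧ Γ.arc p.1 p.2 = x then
    |inner ℝ q (Γ.tangent h.choose.1 h.choose.2)|
  else 0

theorem exists_arc_of_mem_support {x : EuclideanSpace ℝ (Fin N)} (hx : x ∈ Γ.support)
    (hV : x ∉ Γ.vertices) :
    ∃ p : ι × ℝ, p.2 ∈ Ioo 0 (Γ.length p.1) ∧ Γ.arc p.1 p.2 = x := by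
  obtain ⟨i, s, hs, rfl⟩ := mem_iUnion.1 hx
  refine ⟨(i, s), ⟨lt_of_le_of_ne hs.1 ?_, lt_of_le_of_ne hs.2 ?_⟩, rfl⟩
  · rintro rfl
    exact hV ⟨i, Or.inl rfl⟩
  · intro (h : s = Γ.length i)
    exact hV ⟨i, Or.inr (by rw [h])⟩

theorem lagrangian_of_mem_vertices (H : ι → ℝ → ℝ → ℝ → ℝ)
    (c : EuclideanSpace ℝ (Fin N) → ℝ → ℝ) {x : EuclideanSpace ℝ (Fin N)}
    (hx : x ∈ Γ.vertices) (q : EuclideanSpace ℝ (Fin N)) (t : ℝ) :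
    Γ.lagrangian H c x q t = ‖q‖ ^ 2 / 2 + c x t := if_pos hx

theorem effectiveSpeed_of_mem_vertices {x : EuclideanSpace ℝ (Fin N)}
    (hx : x ∈ Γ.vertices) (q : EuclideanSpace ℝ (Fin N)) : Γ.effectiveSpeed x q = ‖q‖ :=
  if_pos hx

theorem exists_lagrangian_eq (H : ι → ℝ → ℝ → ℝ → ℝ) (c : EuclideanSpace ℝ (Fin N) → ℝ → ℝ)
    {x : EuclideanSpace ℝ (Fin N)} (hx : x ∈ Γ.support) (hV : x ∉ Γ.vertices) :
    ∃ i, ∃ s ∈ Ioo 0 (Γ.length i), Γ.arc i s = x ∧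
      (∀ q t, Γ.lagrangian H c x q t = arcLagrangian H i s (inner ℝ q (Γ.tangent i s)) t) ∧
      ∀ q, Γ.effectiveSpeed x q = |inner ℝ q (Γ.tangent i s)| := by
  have h := Γ.exists_arc_of_mem_support hx hV
  refine ⟨h.choose.1, h.choose.2, h.choose_spec.1, h.choose_spec.2, fun q t => ?_, fun q => ?_⟩
  · rw [lagrangian, if_neg hV, dif_pos h]
  · rw [effectiveSpeed, if_neg hV, dif_pos h]

theorem effectiveSpeed_nonneg (x q : EuclideanSpace ℝ (Fin N)) : 0 ≤ Γ.effectiveSpeed x q := by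
  unfold effectiveSpeed
  split_ifs <;> positivity

theorem effectiveSpeed_smul (x q : EuclideanSpace ℝ (Fin N)) {r : ℝ} (hr : 0 ≤ r) :
    Γ.effectiveSpeed x (r • q) = r * Γ.effectiveSpeed x q := by
  unfold effectiveSpeed
  split_ifs
  · rw [norm_smul, Real.norm_of_nonneg hr]
  · rw [real_inner_smul_left, abs_mul, abs_of_nonneg hr]
  · simp

theorem effectiveSpeed_le_norm (x q : EuclideanSpace ℝ (Fin N)) :
    Γ.effectiveSpeed x q ≤ ‖q‖ := by
  unfold effectiveSpeed
  split_ifs with h₁ h₂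
  · exact le_rfl
  · refine (abs_real_inner_le_norm _ _).trans_eq ?_
    rw [tangent, Γ.unit_speed _ _ (Ioo_subset_Icc_self h₂.choose_spec.1), mul_one]
  · positivity

/-- Bounds on the overall Lagrangian on the time interval `[0, T]`: coercivity, local boundedness,
Lipschitz continuity in time, and convexity in the velocity. -/
structure LagrangianBounds (H : ι → ℝ → ℝ → ℝ → ℝ) (c : EuclideanSpace ℝ (Fin N) → ℝ → ℝ)
    (T A α B ε : ℝ) (G : ℝ → ℝ) : Prop where
  A_nonneg : 0 ≤ A
  α_nonneg : 0 ≤ α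
  B_nonneg : 0 ≤ B
  ε_pos : 0 < ε
  speed_le : ∀ x ∈ Γ.support, ∀ q, ∀ t ∈ Icc 0 T,
    Γ.effectiveSpeed x q ≤ Γ.lagrangian H c x q t + A
  le_of_speed_le : ∀ R, ∀ x ∈ Γ.support, ∀ q, ∀ t ∈ Icc 0 T, Γ.effectiveSpeed x q ≤ R →
    Γ.lagrangian H c x q t + A ≤ G R
  time_le : ∀ x ∈ Γ.support, ∀ q, ∀ t ∈ Icc 0 T, ∀ t' ∈ Icc 0 T, |t' - t| < ε →
    Γ.lagrangian H c x q t' ≤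
      Γ.lagrangian H c x q t + (α * Γ.effectiveSpeed x q + B) * |t' - t|
  smul_le : ∀ x ∈ Γ.support, ∀ q, ∀ t ∈ Icc 0 T, ∀ r, 1 ≤ r → r ≤ 2 →
    Γ.lagrangian H c x (r • q) t ≤
      (2 - r) * Γ.lagrangian H c x q t + (r - 1) * Γ.lagrangian H c x ((2 : ℝ) • q) t

variable {Γ}

theorem IsHamiltonian.bddAbove (hH : Γ.IsHamiltonian H) {i : ι} {s t : ℝ}
    (hs : s ∈ Icc 0 (Γ.length i)) (ht : 0 ≤ t) (v : ℝ) :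
    BddAbove (range fun μ => v * μ - H i s t μ) := by
  obtain ⟨θ, Θ, ⟨hm, -, hθ⟩, -, h⟩ := hH.coercive (t + 1) (by positivity)
  exact bddAbove_range_sub hm hθ (fun μ => (h i s hs t ⟨ht, by linarith⟩ μ).1) v

theorem exists_lagrangianBounds (hH : Γ.IsHamiltonian H)
    {c : EuclideanSpace ℝ (Fin N) → ℝ → ℝ} (hc : Γ.IsFluxLimiter H c) {T : ℝ} (hT : 0 < T) :
    ∃ A α B ε G, Γ.LagrangianBounds H c T A α B ε G := by
  obtain ⟨θ, Θ, ⟨hm, -, hθ⟩, -, hco⟩ := hH.coercive T hT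
  obtain ⟨α, β, ε₁, hα, hβ, hε₁, -, hlip⟩ := hH.time_lipschitz T hT
  obtain ⟨D, hD⟩ := hc.bounded T hT
  obtain ⟨β', ε₂, hβ', hε₂, -, hclip⟩ := hc.time_lipschitz T hT
  choose M hM using exists_forall_mul_sub_le_of_superlinear hm hθ
  have hbd : ∀ i, ∀ s ∈ Icc 0 (Γ.length i), ∀ t ∈ Icc 0 T, ∀ v,
      BddAbove (range fun μ => v * μ - H i s t μ) := fun i s hs t ht v =>
    hH.bddAbove hs ht.1 v
  -- `|Θ 1|` serves inside the arcs; at a vertex `|D| + 1` suffices, because `‖q‖ ≤ ‖q‖ ^ 2 / 2 + 1`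
  -- and `c` is at least `-|D|`.
  obtain ⟨A, hA⟩ : ∃ A, A = |Θ 1| + (|D| + 1) := ⟨_, rfl⟩
  have hAΘ : Θ 1 ≤ A := by linarith [le_abs_self (Θ 1), abs_nonneg D]
  have hAD : |D| + 1 ≤ A := by linarith [abs_nonneg (Θ 1)]
  refine ⟨A, α, α * (|Θ 0| + 1) + β + β', min ε₁ ε₂,
    fun R => max (M R) (R ^ 2 / 2 + |D|) + A, ?_⟩
  have hcD : ∀ x ∈ Γ.vertices, ∀ t ∈ Icc 0 T, |c x t| ≤ |D| := fun x hx t ht =>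
    (hD x hx t ht).trans (le_abs_self D)
  constructor
  · linarith [abs_nonneg D]
  · exact hα
  · positivity
  · exact lt_min hε₁ hε₂
  · intro x hx q t ht
    by_cases hV : x ∈ Γ.vertices
    · rw [Γ.lagrangian_of_mem_vertices H c hV, Γ.effectiveSpeed_of_mem_vertices hV]
      nlinarith [sq_nonneg (‖q‖ - 1), (abs_le.1 (hcD x hV t ht)).1]
    · obtain ⟨i, s, hs, rfl, hL, hp⟩ := Γ.exists_lagrangian_eq H c hx hV
      have hs' := Ioo_subset_Icc_self hs
      rw [hL, hp]
      have := abs_sub_le_arcLagrangian (hbd i s hs' t ht (inner ℝ q (Γ.tangent i s)))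
        (fun μ => (hco i s hs' t ht μ).2)
      linarith
  · intro R x hx q t ht hR
    by_cases hV : x ∈ Γ.vertices
    · rw [Γ.effectiveSpeed_of_mem_vertices hV] at hR
      rw [Γ.lagrangian_of_mem_vertices H c hV]
      refine add_le_add_left (le_max_of_le_right ?_) _
      have : ‖q‖ ^ 2 ≤ R ^ 2 := by gcongr
      linarith [(abs_le.1 (hcD x hV t ht)).2]
    · obtain ⟨i, s, hs, rfl, hL, hp⟩ := Γ.exists_lagrangian_eq H c hx hV
      have hs' := Ioo_subset_Icc_self hs
      rw [hp] at hR
      rw [hL]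
      refine add_le_add_left (le_max_of_le_left ?_) _
      exact ciSup_le (sub_le_of_superlinear (hM R) (fun μ => (hco i s hs' t ht μ).1) hR)
  · intro x hx q t ht t' ht' htt
    by_cases hV : x ∈ Γ.vertices
    · rw [Γ.lagrangian_of_mem_vertices H c hV, Γ.lagrangian_of_mem_vertices H c hV,
        Γ.effectiveSpeed_of_mem_vertices hV]
      have h1 := hclip x hV t' ht' t ht (by
        rw [abs_sub_comm]
        exact htt.trans_le (min_le_right _ _))
      rw [abs_sub_comm] at h1
      have h2 : 0 ≤ (α * ‖q‖ + (α * (|Θ 0| + 1) + β)) * |t' - t| := by positivity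
      linarith
    · obtain ⟨i, s, hs, rfl, hL, hp⟩ := Γ.exists_lagrangian_eq H c hx hV
      have hs' := Ioo_subset_Icc_self hs
      rw [hL, hL, hp]
      have h1 := arcLagrangian_le_add (v := inner ℝ q (Γ.tangent i s)) (i := i) (s := s)
        (t := t) (t' := t') (H := H) (Θ := Θ) (β := β) hα
        (hbd i s hs' t ht _) (hbd i s hs' t' ht' _) (fun μ => (hco i s hs' t' ht' μ).2)
        (fun μ => hlip i s hs' μ t ht t' ht' (htt.trans_le (min_le_left _ _)))
      have h2 : 0 ≤ β' * |t' - t| := by positivity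
      linarith
  · intro x hx q t ht r hr₁ hr₂
    by_cases hV : x ∈ Γ.vertices
    · rw [Γ.lagrangian_of_mem_vertices H c hV, Γ.lagrangian_of_mem_vertices H c hV,
        Γ.lagrangian_of_mem_vertices H c hV, norm_smul, norm_smul,
        Real.norm_of_nonneg (by linarith), Real.norm_of_nonneg (by norm_num)]
      nlinarith [mul_nonneg (mul_nonneg (sub_nonneg.2 hr₁) (sub_nonneg.2 hr₂)) (sq_nonneg ‖q‖)]
    · obtain ⟨i, s, hs, rfl, hL, hp⟩ := Γ.exists_lagrangian_eq H c hx hV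
      rw [hL, hL, hL, real_inner_smul_left, real_inner_smul_left]
      exact arcLagrangian_mul_le hr₁ hr₂ (hbd i s (Ioo_subset_Icc_self hs) t ht)

end EmbeddedNetwork

/-! ### Measurability of the Lagrangian along a curve, and the shifted action. -/

theorem IsCompact.continuousOn_invFunOn {X Y : Type*} [TopologicalSpace X] [TopologicalSpace Y]
    [T2Space Y] [Nonempty X] {f : X → Y} {K : Set X} (hK : IsCompact K) (hf : ContinuousOn f K)
    (hi : InjOn f K) : ContinuousOn (Function.invFunOn f K) (f '' K) := by
  rw [continuousOn_iff_isClosed]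
  intro C hC
  refine ⟨f '' (K ∩ C), ((hK.inter_right hC).image_of_continuousOn
    (hf.mono inter_subset_left)).isClosed, ?_⟩
  ext y
  constructor
  · rintro ⟨h, x, hx, rfl⟩
    rw [mem_preimage, hi.leftInvOn_invFunOn hx] at h
    exact ⟨⟨x, ⟨hx, h⟩, rfl⟩, x, hx, rfl⟩
  · rintro ⟨⟨x, ⟨hx, hC⟩, rfl⟩, -⟩
    refine ⟨?_, x, hx, rfl⟩
    rwa [mem_preimage, hi.leftInvOn_invFunOn hx]

namespace EmbeddedNetwork

variable {N : ℕ} {ι : Type*} {Γ : EmbeddedNetwork N ι} {H : ι → ℝ → ℝ → ℝ → ℝ}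

variable (Γ) in
theorem countable_vertices : Γ.vertices.Countable := by
  have := Γ.countable
  refine ((countable_range fun i => Γ.arc i 0).union
    (countable_range fun i => Γ.arc i (Γ.length i))).mono ?_
  rintro x ⟨i, rfl | rfl⟩
  · exact Or.inl ⟨i, rfl⟩
  · exact Or.inr ⟨i, rfl⟩

variable (Γ) in
theorem eq_or_eq_rev_of_arc_eq {i j : ι} {s t : ℝ} (hs : s ∈ Ioo 0 (Γ.length i))
    (ht : t ∈ Icc 0 (Γ.length j)) (h : Γ.arc i s = Γ.arc j t) :
    (j = i ∧ t = s) ∨ (j = Γ.rev i ∧ t = Γ.length i - s) := by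
  have key : ∀ u ∈ Icc 0 (Γ.length i), Γ.arc i s = Γ.arc i u → u = s := by
    intro u hu h
    rcases hu.1.eq_or_lt with h0 | h0
    · exact (Γ.injOn_Ico i ⟨hs.1.le, hs.2⟩ ⟨hu.1, by rw [← h0]; exact Γ.length_pos i⟩ h).symm
    · exact (Γ.injOn_Ioc i ⟨hs.1, hs.2.le⟩ ⟨h0, hu.2⟩ h).symm
  by_cases h1 : j = i
  · subst h1
    exact Or.inl ⟨rfl, key t ht h⟩
  · by_cases h2 : j = Γ.rev i
    · subst h2
      rw [Γ.length_rev] at ht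
      rw [Γ.arc_rev i t ht] at h
      have := key _ ⟨by linarith [ht.2], by linarith [ht.1]⟩ h
      exact Or.inr ⟨rfl, by linarith⟩
    · exact absurd ⟨t, ht, h.symm⟩ (disjoint_left.1 (Γ.disjoint i j h1 h2) ⟨s, hs, rfl⟩)

variable (Γ) in
theorem arc_notMem_vertices {i : ι} {s : ℝ} (hs : s ∈ Ioo 0 (Γ.length i)) :
    Γ.arc i s ∉ Γ.vertices := by
  rintro ⟨j, h | h⟩
  · rcases Γ.eq_or_eq_rev_of_arc_eq hs (left_mem_Icc.2 (Γ.length_pos j).le) h.symm with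
      ⟨-, h⟩ | ⟨-, h⟩ <;> linarith [hs.1, hs.2]
  · rcases Γ.eq_or_eq_rev_of_arc_eq hs (right_mem_Icc.2 (Γ.length_pos j).le) h.symm with
      ⟨rfl, h⟩ | ⟨rfl, h⟩
    · linarith [hs.2]
    · rw [Γ.length_rev] at h
      linarith [hs.1]

variable (Γ) in
theorem tangent_rev {i : ι} {s : ℝ} (hs : s ∈ Icc 0 (Γ.length i)) :
    Γ.tangent (Γ.rev i) s = -Γ.tangent i (Γ.length i - s) := by
  have h : EqOn (Γ.arc (Γ.rev i)) (fun u => Γ.arc i (Γ.length i - u)) (Icc 0 (Γ.length i)) :=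
    fun u hu => Γ.arc_rev i u hu
  rw [tangent, tangent, Γ.length_rev, derivWithin_congr h (h hs), derivWithin_comp_const_sub]
  simp

theorem IsHamiltonian.arcLagrangian_rev (hH : Γ.IsHamiltonian H) {i : ι} {s t : ℝ}
    (hs : s ∈ Icc 0 (Γ.length i)) (ht : 0 ≤ t) (v : ℝ) :
    arcLagrangian H (Γ.rev i) s v t = arcLagrangian H i (Γ.length i - s) (-v) t := by
  unfold arcLagrangian
  rw [← (Equiv.neg ℝ).iSup_comp]
  refine iSup_congr fun μ => ?_
  rw [hH.compat i s hs t ht]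
  simp

/-- Removes the arbitrary choice in `lagrangian`: the chosen arc can only be `i` or its inverse, and
passing to the inverse reverses both the tangent and the sign of the velocity. -/
theorem IsHamiltonian.lagrangian_arc (hH : Γ.IsHamiltonian H)
    (c : EuclideanSpace ℝ (Fin N) → ℝ → ℝ) {i : ι} {s t : ℝ}
    (hs : s ∈ Ioo 0 (Γ.length i)) (ht : 0 ≤ t) (q : EuclideanSpace ℝ (Fin N)) :
    Γ.lagrangian H c (Γ.arc i s) q t = arcLagrangian H i s (inner ℝ q (Γ.tangent i s)) t := by
  obtain ⟨j, u, hu, he, hL, -⟩ := Γ.exists_lagrangian_eq H c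
    (Γ.arc_mem_support i (Ioo_subset_Icc_self hs)) (Γ.arc_notMem_vertices hs)
  rw [hL]
  rcases Γ.eq_or_eq_rev_of_arc_eq hs (Ioo_subset_Icc_self hu) he.symm with ⟨rfl, rfl⟩ | ⟨rfl, rfl⟩
  · rfl
  · have hs' : Γ.length i - s ∈ Icc 0 (Γ.length i) := ⟨by linarith [hs.2], by linarith [hs.1]⟩
    rw [hH.arcLagrangian_rev hs' ht, Γ.tangent_rev hs', inner_neg_right, neg_neg, sub_sub_cancel]

/-- By continuity in `μ` a countable supremum suffices, which preserves measurability. -/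
theorem IsHamiltonian.arcLagrangian_eq_iSup_rat (hH : Γ.IsHamiltonian H) {i : ι} {s t : ℝ}
    (hs : s ∈ Icc 0 (Γ.length i)) (ht : 0 ≤ t) (v : ℝ) :
    arcLagrangian H i s v t = ⨆ μ : ℚ, (v * μ - H i s t μ) := by
  have hb := hH.bddAbove hs ht v
  have hb' : BddAbove (range fun μ : ℚ => v * μ - H i s t μ) :=
    hb.mono (range_subset_iff.2 fun μ => mem_range_self (μ : ℝ))
  have hc : Continuous fun μ : ℝ => H i s t μ := by
    rw [← continuousOn_univ]
    exact (hH.continuousOn i).comp (f := fun μ : ℝ => (s, t, μ))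
      (by fun_prop) fun μ _ => mk_mem_prod hs (mk_mem_prod ht (mem_univ _))
  refine le_antisymm (ciSup_le fun μ => ?_) (ciSup_le fun μ => le_ciSup hb _)
  refine isClosed_property (p := fun μ : ℝ => v * μ - H i s t μ ≤ ⨆ μ : ℚ, (v * μ - H i s t μ))
    Rat.denseRange_cast (isClosed_le (by fun_prop) continuous_const) (fun r => ?_) μ
  exact le_ciSup hb' r

theorem aemeasurable_lagrangian_of_vertex {c : EuclideanSpace ℝ (Fin N) → ℝ → ℝ}
    (hc : Γ.IsFluxLimiter H c) {ξ : ℝ → EuclideanSpace ℝ (Fin N)}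
    {x : EuclideanSpace ℝ (Fin N)} (hx : x ∈ Γ.vertices) {S : Set ℝ} (hS : MeasurableSet S)
    (hS0 : S ⊆ Ici 0) (hξ : ∀ τ ∈ S, ξ τ = x) :
    AEMeasurable (fun τ => Γ.lagrangian H c (ξ τ) (deriv ξ τ) τ) (volume.restrict S) := by
  have h1 : AEMeasurable (fun τ => ‖deriv ξ τ‖ ^ 2 / 2 + c x τ) (volume.restrict S) :=
    (((measurable_deriv ξ).norm.pow_const 2).div_const 2).aemeasurable.add
      (((hc.continuousOn x hx).mono hS0).aemeasurable hS)
  refine h1.congr ((ae_restrict_iff' hS).2 (ae_of_all _ fun τ hτ => ?_))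
  simp only
  rw [hξ τ hτ, Γ.lagrangian_of_mem_vertices H c hx]

/-- On a compact piece `K` of the open arc the parametrisation is a homeomorphism onto its image, so
the arc parameter `σ` of `ξ` depends continuously on time. -/
theorem IsHamiltonian.aemeasurable_lagrangian_of_arc (hH : Γ.IsHamiltonian H)
    (c : EuclideanSpace ℝ (Fin N) → ℝ → ℝ) {ξ : ℝ → EuclideanSpace ℝ (Fin N)}
    {i : ι} {K : Set ℝ} (hK : IsCompact K) (hKi : K ⊆ Ioo 0 (Γ.length i)) {S : Set ℝ}
    (hS : MeasurableSet S) (hS0 : S ⊆ Ici 0) (hξc : ContinuousOn ξ S)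
    (hξ : MapsTo ξ S (Γ.arc i '' K)) :
    AEMeasurable (fun τ => Γ.lagrangian H c (ξ τ) (deriv ξ τ) τ) (volume.restrict S) := by
  have hinj : InjOn (Γ.arc i) K := (Γ.injOn_Ico i).mono (hKi.trans Ioo_subset_Ico_self)
  have hIcc : K ⊆ Icc 0 (Γ.length i) := hKi.trans Ioo_subset_Icc_self
  have hcont : ContinuousOn (Γ.arc i) K := (Γ.contDiffOn i).continuousOn.mono hIcc
  obtain ⟨σ, hσ⟩ : ∃ σ : ℝ → ℝ, σ = fun τ => Function.invFunOn (Γ.arc i) K (ξ τ) := ⟨_, rfl⟩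
  have hσc : ContinuousOn σ S := hσ ▸ (hK.continuousOn_invFunOn hcont hinj).comp hξc hξ
  have hσK : MapsTo σ S K := fun τ hτ => hσ ▸ Function.invFunOn_mem (hξ hτ)
  have hσe : ∀ τ ∈ S, Γ.arc i (σ τ) = ξ τ := fun τ hτ => hσ ▸ Function.invFunOn_eq (hξ hτ)
  have htan : ContinuousOn (fun τ => Γ.tangent i (σ τ)) S :=
    ((Γ.contDiffOn i).continuousOn_derivWithin (uniqueDiffOn_Icc (Γ.length_pos i)) le_rfl).comp
      hσc (hσK.mono_right hIcc)
  have hv : AEMeasurable (fun τ => inner ℝ (deriv ξ τ) (Γ.tangent i (σ τ)))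
      (volume.restrict S) := (measurable_deriv ξ).aemeasurable.inner (htan.aemeasurable hS)
  have hsup : AEMeasurable (fun τ => ⨆ μ : ℚ,
      (inner ℝ (deriv ξ τ) (Γ.tangent i (σ τ)) * μ - H i (σ τ) τ μ)) (volume.restrict S) := by
    refine AEMeasurable.iSup fun μ => (hv.mul_const _).sub (ContinuousOn.aemeasurable ?_ hS)
    exact (hH.continuousOn i).comp (f := fun τ => (σ τ, τ, (μ : ℝ)))
      (hσc.prodMk (continuousOn_id.prodMk continuousOn_const))
      fun τ hτ => ⟨hIcc (hσK hτ), hS0 hτ, mem_univ _⟩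
  refine hsup.congr ((ae_restrict_iff' hS).2 (ae_of_all _ fun τ hτ => ?_))
  simp only
  rw [← hH.arcLagrangian_eq_iSup_rat (hIcc (hσK hτ)) (hS0 hτ), ← hσe τ hτ,
    hH.lagrangian_arc c (hKi (hσK hτ)) (hS0 hτ)]

theorem IsCurve.aemeasurable_lagrangian {c : EuclideanSpace ℝ (Fin N) → ℝ → ℝ}
    {ξ : ℝ → EuclideanSpace ℝ (Fin N)} {a b : ℝ} (hξ : Γ.IsCurve ξ a b)
    (hH : Γ.IsHamiltonian H) (hc : Γ.IsFluxLimiter H c) (ha : 0 ≤ a) :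
    AEMeasurable (fun τ => Γ.lagrangian H c (ξ τ) (deriv ξ τ) τ) (volume.restrict (Icc a b)) := by
  have := Γ.countable
  have := Γ.countable_vertices.to_subtype
  have hcl : ∀ {C : Set (EuclideanSpace ℝ (Fin N))}, IsClosed C →
      MeasurableSet (Icc a b ∩ ξ ⁻¹' C) := fun hC =>
    (hξ.continuousOn.preimage_isClosed_of_isClosed isClosed_Icc hC).measurableSet
  have h0 : ∀ {C : Set (EuclideanSpace ℝ (Fin N))}, Icc a b ∩ ξ ⁻¹' C ⊆ Ici 0 :=
    @fun C τ hτ => ha.trans hτ.1.1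
  -- The time interval is a countable union of closed sets: the times spent at a given vertex, and
  -- those spent in a compact piece of an open arc.
  let K : ι × ℕ → Set ℝ := fun p =>
    Icc (1 / ((p.2 : ℝ) + 1)) (Γ.length p.1 - 1 / ((p.2 : ℝ) + 1))
  have hKi : ∀ p, K p ⊆ Ioo 0 (Γ.length p.1) := fun p s hs => by
    have : 0 < 1 / ((p.2 : ℝ) + 1) := Nat.one_div_pos_of_nat
    exact ⟨this.trans_le hs.1, by linarith [hs.2]⟩
  let S : Γ.vertices ⊕ (ι × ℕ) → Set ℝ := Sum.elim (fun x => Icc a b ∩ ξ ⁻¹' {x.1})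
    fun p => Icc a b ∩ ξ ⁻¹' (Γ.arc p.1 '' K p)
  have hcov : Icc a b ⊆ ⋃ k, S k := by
    intro τ hτ
    rw [mem_iUnion]
    by_cases hV : ξ τ ∈ Γ.vertices
    · exact ⟨Sum.inl ⟨_, hV⟩, hτ, rfl⟩
    · obtain ⟨⟨i, s⟩, hs, he⟩ := Γ.exists_arc_of_mem_support (hξ.mem_support τ hτ) hV
      obtain ⟨n, hn⟩ := exists_nat_one_div_lt (lt_min hs.1 (sub_pos.2 hs.2))
      refine ⟨Sum.inr (i, n), hτ, s, ⟨?_, ?_⟩, he⟩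
      · exact (hn.trans_le (min_le_left _ _)).le
      · have := (hn.trans_le (min_le_right _ _)).le
        simp only at this ⊢
        linarith
  refine AEMeasurable.mono_set hcov (aemeasurable_iUnion_iff.2 ?_)
  rintro (x | p)
  · exact aemeasurable_lagrangian_of_vertex hc x.2 (hcl isClosed_singleton) h0 fun τ hτ => hτ.2
  · refine hH.aemeasurable_lagrangian_of_arc c isCompact_Icc (hKi p) (hcl ?_) h0
      (hξ.continuousOn.mono inter_subset_left) fun τ hτ => hτ.2
    exact (isCompact_Icc.image_of_continuousOn ((Γ.contDiffOn p.1).continuousOn.mono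
      ((hKi p).trans Ioo_subset_Icc_self))).isClosed

/-- The action of a curve, with the Lagrangian shifted by the constant `A`. -/
def shiftedAction (Γ : EmbeddedNetwork N ι) (H : ι → ℝ → ℝ → ℝ → ℝ)
    (c : EuclideanSpace ℝ (Fin N) → ℝ → ℝ) (A : ℝ) (ξ : ℝ → EuclideanSpace ℝ (Fin N))
    (a b : ℝ) : ENNReal :=
  ∫⁻ τ in Icc a b, ENNReal.ofReal (Γ.lagrangian H c (ξ τ) (deriv ξ τ) τ + A)

/-- Pointwise, `(f + A) + f⁻ = f⁺ + A`. Measurability makes the integrals additive, and `f⁻ ≤ A`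
makes the subtracted term finite. -/
theorem IsCurve.action_add {c : EuclideanSpace ℝ (Fin N) → ℝ → ℝ}
    {ξ : ℝ → EuclideanSpace ℝ (Fin N)} {a b A : ℝ} (hξ : Γ.IsCurve ξ a b)
    (hH : Γ.IsHamiltonian H) (hc : Γ.IsFluxLimiter H c) (ha : 0 ≤ a) (hA : 0 ≤ A)
    (hL : ∀ τ ∈ Icc a b, 0 ≤ Γ.lagrangian H c (ξ τ) (deriv ξ τ) τ + A) :
    Γ.action H c ξ a b = (Γ.shiftedAction H c A ξ a b : EReal) - ((A * (b - a) : ℝ) : EReal) := by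
  have hm := hξ.aemeasurable_lagrangian hH hc ha
  obtain ⟨f, hf⟩ : ∃ f, f = fun τ => Γ.lagrangian H c (ξ τ) (deriv ξ τ) τ := ⟨_, rfl⟩
  have hm' : AEMeasurable f (volume.restrict (Icc a b)) := hf ▸ hm
  have hL' : ∀ τ ∈ Icc a b, 0 ≤ f τ + A := hf ▸ hL
  have hsum : (∫⁻ τ in Icc a b, ENNReal.ofReal (f τ + A)) +
      ∫⁻ τ in Icc a b, ENNReal.ofReal (-f τ) =
      (∫⁻ τ in Icc a b, ENNReal.ofReal (f τ)) + ENNReal.ofReal (A * (b - a)) := by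
    have hconst : ENNReal.ofReal (A * (b - a)) = ∫⁻ τ in Icc a b, ENNReal.ofReal A := by
      rw [setLIntegral_const, Real.volume_Icc, ENNReal.ofReal_mul hA]
    have hm'' : AEMeasurable (fun τ => ENNReal.ofReal (-f τ)) (volume.restrict (Icc a b)) :=
      hm'.neg.ennreal_ofReal
    rw [hconst, ← lintegral_add_right' _ hm'',
      ← lintegral_add_right _ measurable_const]
    refine setLIntegral_congr_fun measurableSet_Icc fun τ hτ => ?_
    have := hL' τ hτ
    rcases le_total 0 (f τ) with h | h
    · rw [ENNReal.ofReal_of_nonpos (neg_nonpos.2 h), add_zero, ENNReal.ofReal_add h hA]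
    · rw [ENNReal.ofReal_of_nonpos h, zero_add, ← ENNReal.ofReal_add this (neg_nonneg.2 h)]
      congr 1
      ring
  have hneg : ∫⁻ τ in Icc a b, ENNReal.ofReal (-f τ) ≠ ⊤ := by
    refine ne_top_of_le_ne_top (b := ENNReal.ofReal A * volume (Icc a b)) ?_ ?_
    · rw [Real.volume_Icc]
      exact ENNReal.mul_ne_top ENNReal.ofReal_ne_top ENNReal.ofReal_ne_top
    · rw [← setLIntegral_const]
      exact setLIntegral_mono' measurableSet_Icc fun τ hτ =>
        ENNReal.ofReal_le_ofReal (by linarith [hL' τ hτ])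
  have hba : 0 ≤ A * (b - a) := mul_nonneg hA (sub_nonneg.2 hξ.le)
  have e1 : Γ.action H c ξ a b = ((∫⁻ τ in Icc a b, ENNReal.ofReal (f τ) : ENNReal) : EReal)
    - ((∫⁻ τ in Icc a b, ENNReal.ofReal (-f τ) : ENNReal) : EReal) := hf ▸ rfl
  have e2 : Γ.shiftedAction H c A ξ a b = ∫⁻ τ in Icc a b, ENNReal.ofReal (f τ + A) := hf ▸ rfl
  rw [e1, e2]
  generalize ∫⁻ τ in Icc a b, ENNReal.ofReal (f τ) = P at *
  generalize ∫⁻ τ in Icc a b, ENNReal.ofReal (-f τ) = M at *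
  generalize ∫⁻ τ in Icc a b, ENNReal.ofReal (f τ + A) = J at *
  lift M to NNReal using hneg
  generalize A * (b - a) = D at *
  lift D to NNReal using hba
  rw [ENNReal.ofReal_coe_nnreal] at hsum
  by_cases hP : P = ⊤
  · subst hP
    have : J = ⊤ := by simpa using hsum
    subst this
    rw [EReal.coe_ennreal_top, EReal.top_sub_coe, EReal.coe_nnreal_eq_coe_real,
      EReal.top_sub_coe]
  · have hJ : J ≠ ⊤ := by
      rintro rfl
      rw [top_add] at hsum
      exact hP (by simpa using hsum.symm)
    lift P to NNReal using hP
    lift J to NNReal using hJ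
    have h : (J : ℝ) + M = P + D := by exact_mod_cast hsum
    have : (P : ℝ) - M = J - D := by linarith
    rw [EReal.coe_nnreal_eq_coe_real, EReal.coe_nnreal_eq_coe_real, EReal.coe_nnreal_eq_coe_real,
      ← EReal.coe_sub, ← EReal.coe_sub, this]

end EmbeddedNetwork

/-! ### Bi-Lipschitz changes of time. -/

/-- `σ` is a bi-Lipschitz change of time with speed `w` almost everywhere and inverse `φ`. -/
structure IsTimeChange (w σ φ : ℝ → ℝ) : Prop where
  left_inv : ∀ x, φ (σ x) = x
  right_inv : ∀ y, σ (φ y) = y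
  sub_le : ∀ x y, x ≤ y → σ y - σ x ≤ y - x
  le_sub : ∀ x y, x ≤ y → (y - x) / 2 ≤ σ y - σ x
  half_le : ∀ x, 1 / 2 ≤ w x
  ae_hasDerivAt : ∀ᵐ τ, HasDerivAt σ (w τ) τ

theorem exists_isTimeChange {w : ℝ → ℝ} (hw : Measurable w) (h1 : ∀ x, 1 / 2 ≤ w x)
    (h2 : ∀ x, w x ≤ 1) (a a' : ℝ) :
    ∃ σ φ, IsTimeChange w σ φ ∧ ∀ x, σ x = a' + ∫ τ in a..x, w τ := by
  have hbd : ∀ x, ‖w x‖ ≤ 1 := fun x => by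
    rw [Real.norm_eq_abs, abs_le]
    constructor <;> linarith [h1 x, h2 x]
  have hloc : LocallyIntegrable w volume :=
    (locallyIntegrable_const (1 : ℝ)).mono hw.aestronglyMeasurable (ae_of_all _ fun x => by
      simpa using hbd x)
  have hint : ∀ x y, IntervalIntegrable w volume x y := fun x y =>
    intervalIntegrable_iff.2 ((hloc.integrableOn_isCompact isCompact_uIcc).mono_set
      uIoc_subset_uIcc)
  obtain ⟨σ, hσ⟩ : ∃ σ : ℝ → ℝ, σ = fun x => a' + ∫ τ in a..x, w τ := ⟨_, rfl⟩
  have hsub : ∀ x y, σ y - σ x = ∫ τ in x..y, w τ := fun x y => by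
    rw [← intervalIntegral.integral_interval_sub_left (hint a y) (hint a x), hσ]
    ring
  have hle : ∀ x y, x ≤ y → σ y - σ x ≤ y - x := fun x y hxy => by
    rw [hsub]
    refine (intervalIntegral.integral_mono_on hxy (hint x y)
      (intervalIntegrable_const (c := (1 : ℝ))) fun u _ => h2 u).trans_eq ?_
    simp
  have hge : ∀ x y, x ≤ y → (y - x) / 2 ≤ σ y - σ x := fun x y hxy => by
    rw [hsub]
    refine le_trans (le_of_eq ?_) (intervalIntegral.integral_mono_on hxy
      (intervalIntegrable_const (c := (1 / 2 : ℝ))) (hint x y) fun u _ => h1 u)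
    simp
    ring
  have hcont : Continuous σ := by
    refine (LipschitzWith.of_le_add_mul 1 fun x y => ?_).continuous
    rw [NNReal.coe_one, one_mul, Real.dist_eq]
    rcases le_total x y with h | h
    · linarith [hge x y h, abs_nonneg (x - y)]
    · linarith [hle y x h, le_abs_self (x - y)]
  have hsurj : Function.Surjective σ := by
    refine hcont.surjective ?_ ?_
    · refine tendsto_atTop_mono' atTop (f₁ := fun x => σ 0 + x / 2) ?_
        (tendsto_atTop_add_const_left _ _ (tendsto_id.atTop_div_const two_pos))
      filter_upwards [eventually_ge_atTop 0] with x hx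
      linarith [hge 0 x hx]
    · refine tendsto_atBot_mono' atBot (f₁ := fun x => σ 0 + x / 2) ?_
        (tendsto_atBot_add_const_left _ _ (tendsto_id.atBot_div_const two_pos))
      filter_upwards [eventually_le_atBot 0] with x hx
      linarith [hge x 0 hx]
  have hmono : StrictMono σ := fun x y hxy => by linarith [hge x y hxy.le]
  refine ⟨σ, Function.surjInv hsurj, ⟨fun x => hmono.injective (Function.surjInv_eq hsurj _),
    fun y => Function.surjInv_eq hsurj y, hle, hge, h1, ?_⟩, fun x => by rw [hσ]⟩
  filter_upwards [_root_.LocallyIntegrable.ae_hasDerivAt_integral hloc] with τ hτ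
  rw [hσ]
  exact (hτ a).const_add a'

namespace IsTimeChange

variable {w σ φ : ℝ → ℝ}

theorem strictMono (h : IsTimeChange w σ φ) : StrictMono σ := fun x y hxy => by
  linarith [h.le_sub x y hxy.le]

theorem lipschitzWith (h : IsTimeChange w σ φ) : LipschitzWith 1 σ := by
  refine LipschitzWith.of_le_add_mul 1 fun x y => ?_
  rw [NNReal.coe_one, one_mul, Real.dist_eq]
  rcases le_total x y with hxy | hxy
  · linarith [h.le_sub x y hxy, abs_nonneg (x - y)]
  · linarith [h.sub_le y x hxy, le_abs_self (x - y)]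

theorem monotone_inv (h : IsTimeChange w σ φ) : Monotone φ := fun x y hxy => by
  rw [← h.strictMono.le_iff_le, h.right_inv, h.right_inv]
  exact hxy

theorem lipschitzWith_inv (h : IsTimeChange w σ φ) : LipschitzWith 2 φ := by
  refine LipschitzWith.of_le_add_mul 2 fun x y => ?_
  rw [Real.dist_eq, NNReal.coe_ofNat]
  rcases le_total x y with hxy | hxy
  · linarith [h.monotone_inv hxy, abs_nonneg (x - y)]
  · have := h.le_sub _ _ (h.monotone_inv hxy)
    rw [h.right_inv, h.right_inv] at this
    linarith [le_abs_self (x - y)]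

theorem image_Icc (h : IsTimeChange w σ φ) (a b : ℝ) : σ '' Icc a b = Icc (σ a) (σ b) := by
  ext y
  constructor
  · rintro ⟨x, hx, rfl⟩
    exact ⟨h.strictMono.monotone hx.1, h.strictMono.monotone hx.2⟩
  · intro hy
    refine ⟨φ y, ⟨?_, ?_⟩, h.right_inv y⟩
    · rw [← h.left_inv a]
      exact h.monotone_inv hy.1
    · rw [← h.left_inv b]
      exact h.monotone_inv hy.2

/-- The change of variables formula is applied off the null set where `σ` may fail to have
derivative `w`; its image is null because `σ` is Lipschitz. -/
theorem lintegral_Icc (h : IsTimeChange w σ φ) (a b : ℝ) (g : ℝ → ENNReal) :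
    ∫⁻ s in Icc (σ a) (σ b), g s = ∫⁻ τ in Icc a b, ENNReal.ofReal (w τ) * g (σ τ) := by
  obtain ⟨Z, hZ, hZm, hZ0⟩ := exists_measurable_superset_of_null (ae_iff.1 h.ae_hasDerivAt)
  have hder : ∀ τ ∉ Z, HasDerivAt σ (w τ) τ := fun τ hτ => by
    by_contra hn
    exact hτ (hZ hn)
  have himg0 : volume (σ '' Z) = 0 := by
    have h1 := h.lipschitzWith.hausdorffMeasure_image_le (d := 1) zero_le_one Z
    rw [hausdorffMeasure_real, hZ0, mul_zero] at h1
    exact le_antisymm h1 zero_le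
  have e1 : (Icc a b \ Z : Set ℝ) =ᵐ[volume] Icc a b := by
    refine sdiff_null_ae_eq_self hZ0
  have e2 : (σ '' (Icc a b \ Z) : Set ℝ) =ᵐ[volume] Icc (σ a) (σ b) := by
    rw [image_sdiff h.strictMono.injective, h.image_Icc]
    exact sdiff_null_ae_eq_self himg0
  rw [← Measure.restrict_congr_set e1, ← Measure.restrict_congr_set e2]
  exact lintegral_image_eq_lintegral_deriv_mul_of_monotoneOn (measurableSet_Icc.diff hZm)
    (fun x hx => (hder x hx.2).hasDerivWithinAt) (h.strictMono.monotone.monotoneOn _) g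

/-- Where `ξ` is not differentiable, neither is `ξ ∘ φ`, since `ξ = (ξ ∘ φ) ∘ σ`; both derivatives
then have the default value 0. -/
theorem deriv_comp_inv {E : Type*} [NormedAddCommGroup E] [NormedSpace ℝ E]
    (h : IsTimeChange w σ φ) (ξ : ℝ → E) {τ : ℝ} (hτ : HasDerivAt σ (w τ) τ) :
    deriv (fun s => ξ (φ s)) (σ τ) = (w τ)⁻¹ • deriv ξ τ := by
  have hw : w τ ≠ 0 := (one_half_pos.trans_le (h.half_le τ)).ne'
  have hφ : HasDerivAt φ (w τ)⁻¹ (σ τ) :=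
    HasDerivAt.of_local_left_inverse h.lipschitzWith_inv.continuous.continuousAt
      (by rwa [h.left_inv]) hw (Eventually.of_forall h.right_inv)
  by_cases hd : DifferentiableAt ℝ ξ τ
  · have hd' : HasDerivAt ξ (deriv ξ τ) (φ (σ τ)) := by
      rw [h.left_inv]
      exact hd.hasDerivAt
    exact (hd'.scomp (σ τ) hφ).deriv
  · rw [deriv_zero_of_not_differentiableAt hd, smul_zero]
    refine deriv_zero_of_not_differentiableAt fun hn => hd ?_
    have := (hn.hasDerivAt.scomp τ hτ).differentiableAt
    refine this.congr_of_eventuallyEq (Eventually.of_forall fun s => ?_)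
    simp [Function.comp, h.left_inv]

end IsTimeChange

/-! ### Traversing a curve in a shorter time. -/

namespace EmbeddedNetwork

variable {N : ℕ} {ι : Type*} {Γ : EmbeddedNetwork N ι} {H : ι → ℝ → ℝ → ℝ → ℝ}
  {c : EuclideanSpace ℝ (Fin N) → ℝ → ℝ} {T A α B ε : ℝ} {G : ℝ → ℝ}

namespace LagrangianBounds

theorem add_nonneg (hL : Γ.LagrangianBounds H c T A α B ε G) {x q : EuclideanSpace ℝ (Fin N)}
    {t : ℝ} (hx : x ∈ Γ.support) (ht : t ∈ Icc 0 T) : 0 ≤ Γ.lagrangian H c x q t + A :=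
  (Γ.effectiveSpeed_nonneg x q).trans (hL.speed_le x hx q t ht)

theorem shiftedAction_le (hL : Γ.LagrangianBounds H c T A α B ε G)
    {ξ : ℝ → EuclideanSpace ℝ (Fin N)} {a b R : ℝ} (hξ : Γ.IsCurve ξ a b) (ha : 0 ≤ a)
    (hb : b ≤ T) (hR : ∀ t ∈ Ioo a b, ‖deriv ξ t‖ ≤ R) :
    Γ.shiftedAction H c A ξ a b ≤ ENNReal.ofReal (G R * (b - a)) := by
  rw [shiftedAction, ← Measure.restrict_congr_set Ioo_ae_eq_Icc,
    ENNReal.ofReal_mul' (sub_nonneg.2 hξ.le), ← Real.volume_Ioo, ← setLIntegral_const]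
  refine setLIntegral_mono' measurableSet_Ioo fun τ hτ => ENNReal.ofReal_le_ofReal ?_
  exact hL.le_of_speed_le R _ (hξ.mem_support τ (Ioo_subset_Icc_self hτ)) _ τ
    ⟨ha.trans hτ.1.le, hτ.2.le.trans hb⟩ ((Γ.effectiveSpeed_le_norm _ _).trans (hR τ hτ))

end LagrangianBounds

theorem shiftedAction_curveConcat_le {ξ₁ ξ₂ : ℝ → EuclideanSpace ℝ (Fin N)} {t₁ t₂ t₃ : ℝ}
    (h₁₂ : t₁ ≤ t₂) (h₂₃ : t₂ ≤ t₃) (h : ξ₁ t₂ = ξ₂ t₂) :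
    Γ.shiftedAction H c A (curveConcat ξ₁ ξ₂ t₂) t₁ t₃ ≤
      Γ.shiftedAction H c A ξ₁ t₁ t₂ + Γ.shiftedAction H c A ξ₂ t₂ t₃ := by
  rw [shiftedAction, ← Icc_union_Icc_eq_Icc h₁₂ h₂₃]
  refine (lintegral_union_le _ _ _).trans (add_le_add (le_of_eq ?_) (le_of_eq ?_))
  · rw [shiftedAction, ← Measure.restrict_congr_set Ioo_ae_eq_Icc]
    refine setLIntegral_congr_fun measurableSet_Ioo fun τ hτ => ?_
    simp only [curveConcat_of_le hτ.2.le, deriv_curveConcat_of_lt hτ.2]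
  · rw [shiftedAction, ← Measure.restrict_congr_set Ioo_ae_eq_Icc]
    refine setLIntegral_congr_fun measurableSet_Ioo fun τ hτ => ?_
    simp only [curveConcat_of_ge h hτ.1.le, deriv_curveConcat_of_gt hτ.1]

namespace LagrangianBounds

/-- Convexity with `r = w⁻¹` gives weights `2 w - 1` and `1 - w` after multiplication by `w`. The
factor `w` also cancels the `w⁻¹` of the accelerated speed in the time error, and the speed is
absorbed into `L + A`. The bound `g` is left free: it is 0 where `w = 1`. -/
theorem timeChange_le (hL : Γ.LagrangianBounds H c T A α B ε G)
    {x q : EuclideanSpace ℝ (Fin N)} (hx : x ∈ Γ.support) {w t t' Δ g : ℝ} (hw₁ : 1 / 2 ≤ w)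
    (hw₂ : w ≤ 1) (ht : t ∈ Icc 0 T) (ht' : t' ∈ Icc 0 T) (hΔ : |t' - t| ≤ Δ) (hΔε : Δ < ε)
    (hg : (1 - w) * (Γ.lagrangian H c x ((2 : ℝ) • q) t + A) ≤ g) :
    w * (Γ.lagrangian H c x (w⁻¹ • q) t' + A) ≤
      (1 + α * Δ) * (Γ.lagrangian H c x q t + A) + (g + B * Δ) := by
  have hw0 : 0 < w := one_half_pos.trans_le hw₁
  have hr₁ : 1 ≤ w⁻¹ := (one_le_inv₀ hw0).2 hw₂
  have hr₂ : w⁻¹ ≤ 2 := (inv_le_comm₀ hw0 two_pos).2 (by linarith)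
  have h1 := hL.time_le x hx (w⁻¹ • q) t ht t' ht' (hΔ.trans_lt hΔε)
  have h2 := hL.smul_le x hx q t ht _ hr₁ hr₂
  rw [Γ.effectiveSpeed_smul x q (by positivity)] at h1
  have hF := hL.add_nonneg (q := q) hx ht
  have hp := hL.speed_le x hx q t ht
  have hp0 := Γ.effectiveSpeed_nonneg x q
  have hα := hL.α_nonneg
  have hB := hL.B_nonneg
  have hΔ0 : 0 ≤ Δ := (abs_nonneg _).trans hΔ
  have h3 : (α * (w⁻¹ * Γ.effectiveSpeed x q) + B) * |t' - t| ≤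
      (α * (w⁻¹ * Γ.effectiveSpeed x q) + B) * Δ := by
    have : 0 < w⁻¹ := by positivity
    gcongr
  generalize Γ.lagrangian H c x q t = L₀ at *
  generalize Γ.lagrangian H c x ((2 : ℝ) • q) t = L₂ at *
  generalize Γ.lagrangian H c x (w⁻¹ • q) t = L₁ at *
  generalize Γ.lagrangian H c x (w⁻¹ • q) t' = L₁' at *
  generalize Γ.effectiveSpeed x q = p at *
  have h4 : L₁' + A ≤ ((2 - w⁻¹) * (L₀ + A) + (w⁻¹ - 1) * (L₂ + A)) +
      (α * (w⁻¹ * p) + B) * Δ := by linarith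
  have h5 := mul_le_mul_of_nonneg_left h4 hw0.le
  have h6 : w * (((2 - w⁻¹) * (L₀ + A) + (w⁻¹ - 1) * (L₂ + A)) + (α * (w⁻¹ * p) + B) * Δ) =
      (2 * w - 1) * (L₀ + A) + (1 - w) * (L₂ + A) + α * Δ * p + w * (B * Δ) := by
    field_simp
    ring
  rw [h6] at h5
  have h7 : (2 * w - 1) * (L₀ + A) ≤ 1 * (L₀ + A) := by
    gcongr
    linarith
  have h8 : α * Δ * p ≤ α * Δ * (L₀ + A) := by gcongr
  have h9 : w * (B * Δ) ≤ 1 * (B * Δ) := by gcongr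
  linarith

/-- A curve of small action can be traversed in a slightly shorter time, at the cost of an
increase of the action which is proportional to the change of the time interval. -/
theorem exists_compressed (hL : Γ.LagrangianBounds H c T A α B ε G)
    (hH : Γ.IsHamiltonian H) (hc : Γ.IsFluxLimiter H c)
    {ξ : ℝ → EuclideanSpace ℝ (Fin N)} {a b M a' d Δ : ℝ} (hξ : Γ.IsCurve ξ a b) (ha : 0 ≤ a)
    (hab : a < b) (hb : b ≤ T) (hM : 0 < M)
    (hJ : Γ.shiftedAction H c A ξ a b ≤ ENNReal.ofReal (M * (b - a)))
    (hd : 0 ≤ d) (hdle : d ≤ (b - a) / 4) (ha' : 0 ≤ a') (hb' : a' + (b - a) - d ≤ T)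
    (hΔ : |a' - a| + d ≤ Δ) (hΔε : Δ < ε) :
    ∃ ξ', Γ.IsCurve ξ' a' (a' + (b - a) - d) ∧ ξ' a' = ξ a ∧ ξ' (a' + (b - a) - d) = ξ b ∧
      Γ.shiftedAction H c A ξ' a' (a' + (b - a) - d) ≤ Γ.shiftedAction H c A ξ a b +
        ENNReal.ofReal (Δ * (α * M * T + B * T) + d * |G (4 * M)|) := by
  have hba : 0 < b - a := sub_pos.2 hab
  have hΔ0 : 0 ≤ Δ := by linarith [abs_nonneg (a' - a)]
  have hsupp := hξ.mem_support
  have htime : ∀ τ ∈ Icc a b, τ ∈ Icc 0 T := fun τ hτ => ⟨ha.trans hτ.1, hτ.2.trans hb⟩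
  have hα := hL.α_nonneg
  have hB := hL.B_nonneg
  obtain ⟨F, hF⟩ : ∃ F : ℝ → ℝ, F = fun τ => Γ.lagrangian H c (ξ τ) (deriv ξ τ) τ + A := ⟨_, rfl⟩
  have hFm : AEMeasurable F (volume.restrict (Icc a b)) :=
    hF ▸ (hξ.aemeasurable_lagrangian hH hc ha).add_const A
  have hJF : Γ.shiftedAction H c A ξ a b = ∫⁻ τ in Icc a b, ENNReal.ofReal (F τ) := hF ▸ rfl
  obtain ⟨f, hf, hfF⟩ := hFm
  -- the set of times of moderate speed
  obtain ⟨E, hE⟩ : ∃ E : Set ℝ, E = Icc a b ∩ {τ | f τ ≤ 2 * M} := ⟨_, rfl⟩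
  have hEm : MeasurableSet E := hE ▸ measurableSet_Icc.inter (measurableSet_le hf measurable_const)
  have hEab : E ⊆ Icc a b := hE ▸ inter_subset_left
  have hEfin : volume E ≠ ⊤ := ne_top_of_le_ne_top (by simp) (measure_mono hEab)
  -- Chebyshev's inequality: the mean of the shifted Lagrangian is at most `M`, so it exceeds `2 M`
  -- for at most half of the time.
  have hEvol : (b - a) / 2 ≤ volume.real E := by
    have h1 : ENNReal.ofReal (2 * M) * volume (Icc a b \ E) ≤ ENNReal.ofReal (M * (b - a)) := by
      refine le_trans ?_ (hJF ▸ hJ)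
      rw [lintegral_congr_ae (g := fun τ => ENNReal.ofReal (f τ))
        (hfF.mono fun τ h => by simp only [h]), ← setLIntegral_const]
      refine le_trans (setLIntegral_mono' (measurableSet_Icc.diff hEm) fun τ hτ => ?_)
        (lintegral_mono_set sdiff_subset)
      refine ENNReal.ofReal_le_ofReal ?_
      by_contra hcon
      exact hτ.2 (hE ▸ ⟨hτ.1, (not_le.1 hcon).le⟩)
    have h2 : volume (Icc a b \ E) ≠ ⊤ :=
      ne_top_of_le_ne_top (by simp) (measure_mono sdiff_subset)
    rw [← ENNReal.ofReal_toReal h2, ← ENNReal.ofReal_mul (by positivity),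
      ENNReal.ofReal_le_ofReal_iff (by positivity)] at h1
    have h3 : volume.real (Icc a b \ E) = (b - a) - volume.real E := by
      rw [measureReal_sdiff hEab hEm measure_Icc_lt_top.ne, Real.volume_real_Icc_of_le hab.le]
    have h4 : (volume (Icc a b \ E)).toReal = volume.real (Icc a b \ E) := rfl
    rw [h4, h3] at h1
    nlinarith
  have hEpos : 0 < volume.real E := by linarith
  -- Running with `w = 1 - κ` on `E` and `w = 1` elsewhere saves exactly `d`; since `d ≤ (b - a) /
  -- 4` and `E` fills at least half of `[a, b]`, `κ ≤ 1 / 2`.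
  obtain ⟨κ, hκ⟩ : ∃ κ, κ = d / volume.real E := ⟨_, rfl⟩
  have hκ0 : 0 ≤ κ := hκ ▸ div_nonneg hd hEpos.le
  have hκE : κ * volume.real E = d := by rw [hκ, div_mul_cancel₀ _ hEpos.ne']
  have hκ1 : κ ≤ 1 / 2 := by
    rw [hκ, div_le_iff₀ hEpos]
    linarith
  obtain ⟨w, hw⟩ : ∃ w : ℝ → ℝ, w = fun τ => 1 - E.indicator (fun _ => κ) τ := ⟨_, rfl⟩
  have hwE : ∀ τ ∈ E, w τ = 1 - κ := fun τ hτ => by rw [hw]; simp [hτ]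
  have hwE' : ∀ τ ∉ E, w τ = 1 := fun τ hτ => by rw [hw]; simp [hτ]
  have hwm : Measurable w := hw ▸ measurable_const.sub (measurable_const.indicator hEm)
  have hw₁ : ∀ τ, 1 / 2 ≤ w τ := fun τ => by
    by_cases h : τ ∈ E
    · rw [hwE τ h]; linarith
    · rw [hwE' τ h]; norm_num
  have hw₂ : ∀ τ, w τ ≤ 1 := fun τ => by
    by_cases h : τ ∈ E
    · rw [hwE τ h]; linarith
    · rw [hwE' τ h]
  obtain ⟨σ, φ, hσ, hσe⟩ := exists_isTimeChange hwm hw₁ hw₂ a a'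
  have hσa : σ a = a' := by rw [hσe]; simp
  have hσb : σ b = a' + (b - a) - d := by
    have hI : ∫ τ in a..b, E.indicator (fun _ => κ) τ = d := by
      rw [intervalIntegral.integral_of_le hab.le, ← integral_Icc_eq_integral_Ioc,
        setIntegral_indicator hEm, inter_eq_self_of_subset_right hEab, setIntegral_const,
        smul_eq_mul, mul_comm, hκE]
    have hint : IntervalIntegrable (E.indicator fun _ => κ) volume a b := by
      rw [intervalIntegrable_iff]
      exact (intervalIntegrable_iff.1 (intervalIntegrable_const (c := κ))).indicator hEm
    rw [hσe, hw, intervalIntegral.integral_sub intervalIntegrable_const hint, hI]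
    simp
    ring
  have hσΔ : ∀ τ ∈ Icc a b, |σ τ - τ| ≤ Δ := fun τ hτ => by
    have h1 := hσ.sub_le a τ hτ.1
    have h2 := hσ.sub_le τ b hτ.2
    rw [hσa] at h1
    rw [hσb] at h2
    rw [abs_le]
    constructor <;> linarith [le_abs_self (a' - a), neg_abs_le (a' - a)]
  have hle : a' ≤ a' + (b - a) - d := by linarith
  have hφ : MapsTo φ (Icc a' (a' + (b - a) - d)) (Icc a b) := fun s hs => by
    rw [← hσb, ← hσa, ← hσ.image_Icc] at hs
    obtain ⟨τ, hτ, rfl⟩ := hs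
    rwa [hσ.left_inv]
  have hcurve : Γ.IsCurve (fun s => ξ (φ s)) a' (a' + (b - a) - d) :=
    hξ.comp_monotoneOn hle (hσ.monotone_inv.monotoneOn _) hσ.lipschitzWith_inv.lipschitzOnWith hφ
  refine ⟨fun s => ξ (φ s), hcurve, ?_, ?_, ?_⟩
  · simp only [← hσa, hσ.left_inv]
  · simp only [← hσb, hσ.left_inv]
  have hστ : ∀ τ ∈ Icc a b, σ τ ∈ Icc 0 T := fun τ hτ => by
    have : σ τ ∈ Icc (σ a) (σ b) := ⟨hσ.strictMono.monotone hτ.1, hσ.strictMono.monotone hτ.2⟩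
    rw [hσa, hσb] at this
    exact ⟨ha'.trans this.1, this.2.trans hb'⟩
  have hpt : ∀ᵐ τ ∂(volume.restrict (Icc a b)), ENNReal.ofReal (w τ) *
      ENNReal.ofReal (Γ.lagrangian H c (ξ (φ (σ τ))) (deriv (fun s => ξ (φ s)) (σ τ)) (σ τ) + A) ≤
      ENNReal.ofReal (1 + α * Δ) * ENNReal.ofReal (F τ) +
        (E.indicator (fun _ => ENNReal.ofReal (κ * |G (4 * M)|)) τ + ENNReal.ofReal (B * Δ)) := by
    filter_upwards [ae_restrict_mem measurableSet_Icc, hfF, ae_restrict_of_ae hσ.ae_hasDerivAt]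
      with τ hτ hfτ hdτ
    have hw0 : 0 ≤ w τ := by linarith [hw₁ τ]
    have hFτ : F τ = Γ.lagrangian H c (ξ τ) (deriv ξ τ) τ + A := by rw [hF]
    have hF0 : 0 ≤ F τ := hFτ ▸ hL.add_nonneg (hsupp τ hτ) (htime τ hτ)
    rw [hσ.deriv_comp_inv ξ hdτ, hσ.left_inv, ← ENNReal.ofReal_mul hw0,
      ← ENNReal.ofReal_mul (by positivity)]
    have key := fun g hg => hL.timeChange_le (q := deriv ξ τ) (g := g) (hsupp τ hτ) (hw₁ τ)
      (hw₂ τ) (htime τ hτ) (hστ τ hτ) (hσΔ τ hτ) hΔε hg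
    rw [← hFτ] at key
    by_cases hτE : τ ∈ E
    · rw [indicator_of_mem hτE, ← ENNReal.ofReal_add (by positivity) (by positivity),
        ← ENNReal.ofReal_add (by positivity) (by positivity)]
      refine ENNReal.ofReal_le_ofReal (key _ ?_)
      have hτM : F τ ≤ 2 * M := by
        rw [hfτ]
        rw [hE] at hτE
        exact hτE.2
      -- On `E` the speed is at most `2 M`; convexity requires the Lagrangian at twice the velocity.
      have hsp : Γ.effectiveSpeed (ξ τ) ((2 : ℝ) • deriv ξ τ) ≤ 4 * M := by
        rw [Γ.effectiveSpeed_smul _ _ zero_le_two]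
        linarith [hL.speed_le _ (hsupp τ hτ) (deriv ξ τ) τ (htime τ hτ)]
      have hG := hL.le_of_speed_le _ _ (hsupp τ hτ) _ τ (htime τ hτ) hsp
      rw [hwE τ hτE, sub_sub_cancel]
      exact mul_le_mul_of_nonneg_left (hG.trans (le_abs_self _)) hκ0
    · rw [indicator_of_notMem hτE, zero_add, ← ENNReal.ofReal_add (by positivity) (by positivity)]
      refine ENNReal.ofReal_le_ofReal ((key 0 ?_).trans_eq (by rw [zero_add]))
      rw [hwE' τ hτE, sub_self, zero_mul]
  have hJM : ∫⁻ τ in Icc a b, ENNReal.ofReal (F τ) ≤ ENNReal.ofReal (M * (b - a)) := hJF ▸ hJ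
  have hFm : AEMeasurable F (volume.restrict (Icc a b)) := ⟨f, hf, hfF⟩
  calc Γ.shiftedAction H c A (fun s => ξ (φ s)) a' (a' + (b - a) - d)
      = ∫⁻ τ in Icc a b, ENNReal.ofReal (w τ) * ENNReal.ofReal
          (Γ.lagrangian H c (ξ (φ (σ τ))) (deriv (fun s => ξ (φ s)) (σ τ)) (σ τ) + A) := by
        rw [shiftedAction, ← hσb, ← hσa, hσ.lintegral_Icc]
    _ ≤ ∫⁻ τ in Icc a b, (ENNReal.ofReal (1 + α * Δ) * ENNReal.ofReal (F τ) +
        (E.indicator (fun _ => ENNReal.ofReal (κ * |G (4 * M)|)) τ +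
          ENNReal.ofReal (B * Δ))) := lintegral_mono_ae hpt
    _ = ENNReal.ofReal (1 + α * Δ) * (∫⁻ τ in Icc a b, ENNReal.ofReal (F τ)) +
        (ENNReal.ofReal (κ * |G (4 * M)|) * volume E +
          ENNReal.ofReal (B * Δ) * ENNReal.ofReal (b - a)) := by
        rw [lintegral_add_right _ (by fun_prop (disch := assumption)),
          lintegral_add_right _ measurable_const,
          lintegral_const_mul' _ _ ENNReal.ofReal_ne_top, setLIntegral_const, Real.volume_Icc,
          lintegral_indicator hEm, lintegral_const, Measure.restrict_restrict hEm,
          inter_eq_self_of_subset_left hEab, Measure.restrict_apply_univ]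
    _ ≤ (∫⁻ τ in Icc a b, ENNReal.ofReal (F τ)) +
        ENNReal.ofReal (Δ * (α * M * T + B * T) + d * |G (4 * M)|) := by
        rw [ENNReal.ofReal_add zero_le_one (by positivity), ENNReal.ofReal_one, add_mul, one_mul,
          add_assoc]
        refine add_le_add_right ?_ _
        have hVE : volume E = ENNReal.ofReal (volume.real E) := (ENNReal.ofReal_toReal hEfin).symm
        rw [hVE, ← ENNReal.ofReal_mul (by positivity), ← ENNReal.ofReal_mul (by positivity),
          ← ENNReal.ofReal_add (by positivity) (by positivity)]
        refine (add_le_add_left (mul_le_mul_right hJM _) _).trans ?_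
        rw [← ENNReal.ofReal_mul (by positivity),
          ← ENNReal.ofReal_add (by positivity) (by positivity)]
        refine ENNReal.ofReal_le_ofReal ?_
        have e1 : κ * |G (4 * M)| * volume.real E = d * |G (4 * M)| := by
          rw [mul_right_comm, hκE]
        have e2 : b - a ≤ T := by linarith
        have e3 : α * Δ * (M * (b - a)) ≤ α * Δ * (M * T) := by gcongr
        have e4 : B * Δ * (b - a) ≤ B * Δ * T := by gcongr
        linarith
    _ = _ := by rw [hJF]

end LagrangianBounds

end EmbeddedNetwork

/-! ### Moving the endpoints, and the Lipschitz estimate. -/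

namespace EmbeddedNetwork

variable {N : ℕ} {ι : Type*} {Γ : EmbeddedNetwork N ι} {H : ι → ℝ → ℝ → ℝ → ℝ}
  {c : EuclideanSpace ℝ (Fin N) → ℝ → ℝ} {T A α B ε C : ℝ} {G : ℝ → ℝ}

theorem le_of_mem_admissibleSet (hC : 0 < C) {x₁ x₂ : EuclideanSpace ℝ (Fin N)} {t₁ t₂ : ℝ}
    (h : (x₁, t₁, x₂, t₂) ∈ Γ.admissibleSet T C) : t₁ ≤ t₂ := by
  have h1 : Γ.geodesicDist x₁ x₂ ≤ C * (t₂ - t₁) := h.2.2.2.2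
  have h2 := nonneg_of_mul_nonneg_right ((Γ.geodesicDist_nonneg x₁ x₂).trans h1) hC
  linarith

/-- The speed `C + 1` instead of `C` avoids the need for a minimising curve. If `t₁ = t₂`, the
endpoints coincide and a constant curve serves. -/
theorem exists_isCurve_of_mem_admissibleSet (hC : 0 < C) {x₁ x₂ : EuclideanSpace ℝ (Fin N)}
    {t₁ t₂ : ℝ} (h : (x₁, t₁, x₂, t₂) ∈ Γ.admissibleSet T C) :
    ∃ ξ, Γ.IsCurve ξ t₁ t₂ ∧ ξ t₁ = x₁ ∧ ξ t₂ = x₂ ∧ ∀ t ∈ Ioo t₁ t₂, ‖deriv ξ t‖ ≤ C + 1 := by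
  have hd : Γ.geodesicDist x₁ x₂ ≤ C * (t₂ - t₁) := h.2.2.2.2
  have hx₁ : x₁ ∈ Γ.support := h.1
  have hx₂ : x₂ ∈ Γ.support := h.2.2.1
  rcases (le_of_mem_admissibleSet hC h).eq_or_lt with rfl | hlt
  · rw [sub_self, mul_zero] at hd
    refine ⟨fun _ => x₁, Γ.isCurve_of_lipschitzOnWith le_rfl
      (LipschitzWith.const x₁).lipschitzOnWith fun _ _ => hx₁, rfl,
      Γ.eq_of_geodesicDist_le_zero hx₁ hx₂ hd, fun t ht => ?_⟩
    exact absurd ht.2 ht.1.le.not_gt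
  · exact Γ.exists_isCurve_norm_deriv_le hx₁ hx₂ hlt (by nlinarith)

theorem exists_isCurve_norm_deriv_le_two {x y : EuclideanSpace ℝ (Fin N)}
    (hx : x ∈ Γ.support) (hy : y ∈ Γ.support) {a b : ℝ} (hab : a < b)
    (h : Γ.geodesicDist x y ≤ b - a ∨ Γ.geodesicDist y x ≤ b - a) :
    ∃ ξ, Γ.IsCurve ξ a b ∧ ξ a = x ∧ ξ b = y ∧ ∀ t ∈ Ioo a b, ‖deriv ξ t‖ ≤ 2 := by
  rcases h with h | h
  · exact Γ.exists_isCurve_norm_deriv_le hx hy hab (by linarith)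
  · exact Γ.exists_isCurve_norm_deriv_le_symm hy hx hab (by linarith)

namespace LagrangianBounds

theorem exists_shiftedAction_le (hL : Γ.LagrangianBounds H c T A α B ε G) (hC : 0 < C)
    {x₁ x₂ : EuclideanSpace ℝ (Fin N)} {t₁ t₂ : ℝ} (h : (x₁, t₁, x₂, t₂) ∈ Γ.admissibleSet T C) :
    ∃ ξ, Γ.IsCurve ξ t₁ t₂ ∧ ξ t₁ = x₁ ∧ ξ t₂ = x₂ ∧
      Γ.shiftedAction H c A ξ t₁ t₂ ≤ ENNReal.ofReal (max (G (C + 1)) 1 * (t₂ - t₁)) := by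
  obtain ⟨ξ, hξ, h1, h2, hd⟩ := exists_isCurve_of_mem_admissibleSet hC h
  refine ⟨ξ, hξ, h1, h2, (hL.shiftedAction_le hξ h.2.1.1 h.2.2.2.1.2 hd).trans ?_⟩
  exact ENNReal.ofReal_le_ofReal (mul_le_mul_of_nonneg_right (le_max_left _ _)
    (sub_nonneg.2 hξ.le))

theorem exists_perturbed (hL : Γ.LagrangianBounds H c T A α B ε G)
    (hH : Γ.IsHamiltonian H) (hc : Γ.IsFluxLimiter H c) (hT : 0 < T) (hC : 0 < C) :
    ∃ K, 0 ≤ K ∧ ∀ x₁ t₁ x₂ t₂ y₁ r₁ y₂ r₂ h, (x₁, t₁, x₂, t₂) ∈ Γ.admissibleSet T C →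
      (y₁, r₁, y₂, r₂) ∈ Γ.admissibleSet T C → 0 < h →
      (Γ.geodesicDist x₁ y₁ ≤ h ∨ Γ.geodesicDist y₁ x₁ ≤ h) →
      (Γ.geodesicDist x₂ y₂ ≤ h ∨ Γ.geodesicDist y₂ x₂ ≤ h) →
      |t₁ - r₁| ≤ h → |t₂ - r₂| ≤ h →
      ∀ ξ, Γ.IsCurve ξ t₁ t₂ → ξ t₁ = x₁ → ξ t₂ = x₂ →
      ∃ ξ', Γ.IsCurve ξ' r₁ r₂ ∧ ξ' r₁ = y₁ ∧ ξ' r₂ = y₂ ∧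
        Γ.shiftedAction H c A ξ' r₁ r₂ ≤
          Γ.shiftedAction H c A ξ t₁ t₂ + ENNReal.ofReal (K * h) := by
  obtain ⟨M, hM⟩ : ∃ M, M = max (G (C + 1)) 1 := ⟨_, rfl⟩
  have hM0 : 0 < M := hM ▸ one_pos.trans_le (le_max_right _ _)
  have hα := hL.α_nonneg
  have hB := hL.B_nonneg
  have hε := hL.ε_pos
  -- `K₁` pays for the case of a short interval or large `h`; `K₂` pays for compression and the two
  -- end pieces.
  obtain ⟨K₁, hK₁⟩ : ∃ K₁, K₁ = M * (18 + 6 * T / ε) := ⟨_, rfl⟩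
  obtain ⟨K₂, hK₂⟩ : ∃ K₂, K₂ = 6 * (α * M * T + B * T) + 4 * |G (4 * M)| + 2 * |G 2| :=
    ⟨_, rfl⟩
  have hK₁0 : 0 ≤ K₁ := by rw [hK₁]; positivity
  have hK₂0 : 0 ≤ K₂ := by rw [hK₂]; positivity
  refine ⟨K₁ + K₂, by positivity, ?_⟩
  intro x₁ t₁ x₂ t₂ y₁ r₁ y₂ r₂ h hp hp' hh hd₁ hd₂ ht₁ ht₂ ξ hξ hξ₁ hξ₂
  have ht12 := hξ.le
  have hr12 := le_of_mem_admissibleSet hC hp'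
  obtain ⟨ht₁l, ht₁u⟩ : 0 ≤ t₁ ∧ t₁ ≤ T := hp.2.1
  obtain ⟨ht₂l, ht₂u⟩ : 0 ≤ t₂ ∧ t₂ ≤ T := hp.2.2.2.1
  obtain ⟨hr₁l, hr₁u⟩ : 0 ≤ r₁ ∧ r₁ ≤ T := hp'.2.1
  obtain ⟨hr₂l, hr₂u⟩ : 0 ≤ r₂ ∧ r₂ ≤ T := hp'.2.2.2.1
  have ht₁' := abs_le.1 ht₁
  have ht₂' := abs_le.1 ht₂
  -- Compression will need `d ≤ (t₂ - t₁) / 4` and a time shift below `ε`; the thresholds come from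
  -- `d ≤ 4 h` and a shift of at most `6 h`. In the present case `r₂ - r₁` is itself `O(h)`.
  by_cases hsmall : t₂ - t₁ ≤ 16 * h ∨ ε ≤ 6 * h
  · obtain ⟨ζ, hζ, h1, h2, hJ⟩ := hL.exists_shiftedAction_le hC hp'
    refine ⟨ζ, hζ, h1, h2, hJ.trans (le_add_left (ENNReal.ofReal_le_ofReal ?_))⟩
    rw [← hM]
    have hlen : r₂ - r₁ ≤ (18 + 6 * T / ε) * h := by
      have hnn : 0 ≤ 6 * T / ε * h := by positivity
      rcases hsmall with hs | hs
      · linarith [ht₁'.1, ht₂'.1]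
      · have : T ≤ 6 * T / ε * h := by
          rw [div_mul_eq_mul_div, le_div_iff₀ hε]
          nlinarith
        linarith
    calc M * (r₂ - r₁) ≤ M * ((18 + 6 * T / ε) * h) := by gcongr
      _ = K₁ * h := by rw [hK₁]; ring
      _ ≤ (K₁ + K₂) * h := by nlinarith [mul_nonneg hK₂0 hh.le]
  · rw [not_or, not_le, not_le] at hsmall
    obtain ⟨hlong, hhε⟩ := hsmall
    -- a competitor whose action is at most `M (t₂ - t₁)`
    obtain ⟨η, hη, hη₁, hη₂, hηM, hηξ⟩ : ∃ η, Γ.IsCurve η t₁ t₂ ∧ η t₁ = x₁ ∧ η t₂ = x₂ ∧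
        Γ.shiftedAction H c A η t₁ t₂ ≤ ENNReal.ofReal (M * (t₂ - t₁)) ∧
        Γ.shiftedAction H c A η t₁ t₂ ≤ Γ.shiftedAction H c A ξ t₁ t₂ := by
      rcases le_total (Γ.shiftedAction H c A ξ t₁ t₂) (ENNReal.ofReal (M * (t₂ - t₁))) with hle | hle
      · exact ⟨ξ, hξ, hξ₁, hξ₂, hle, le_rfl⟩
      · obtain ⟨ζ, hζ, h1, h2, hJ⟩ := hL.exists_shiftedAction_le hC hp
        rw [← hM] at hJ
        exact ⟨ζ, hζ, h1, h2, hJ, hJ.trans hle⟩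
    -- The gain that makes the compressed curve, started at `r₁ + h`, end at `r₂ - h`.
    obtain ⟨d, hd⟩ : ∃ d, d = (t₂ - t₁) - (r₂ - r₁) + 2 * h := ⟨_, rfl⟩
    have hd0 : 0 ≤ d := by linarith [ht₁'.2, ht₂'.1]
    have hd4 : d ≤ 4 * h := by linarith [ht₁'.1, ht₂'.2]
    have hend : r₁ + h + (t₂ - t₁) - d = r₂ - h := by rw [hd]; ring
    have hΔ : |r₁ + h - t₁| + d ≤ 6 * h := by
      have : |r₁ + h - t₁| ≤ 2 * h := abs_le.2 ⟨by linarith [ht₁'.2], by linarith [ht₁'.1]⟩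
      linarith
    obtain ⟨ξ₂, hξ₂c, e₁, e₂, hJ₂⟩ := hL.exists_compressed hH hc hη ht₁l (by linarith) ht₂u hM0 hηM
      hd0 (by linarith) (a' := r₁ + h) (by linarith) (by rw [hend]; linarith) hΔ hhε
    rw [hend] at hξ₂c e₂ hJ₂
    rw [hη₁] at e₁
    rw [hη₂] at e₂
    obtain ⟨ξ₁, hξ₁c, f₁, f₂, hs₁⟩ := exists_isCurve_norm_deriv_le_two (x := y₁) (y := x₁)
      (a := r₁) (b := r₁ + h) hp'.1 hp.1 (by linarith) (by rw [add_sub_cancel_left]; exact hd₁.symm)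
    obtain ⟨ξ₃, hξ₃c, g₁, g₂, hs₃⟩ := exists_isCurve_norm_deriv_le_two (x := x₂) (y := y₂)
      (a := r₂ - h) (b := r₂) hp.2.2.1 hp'.2.2.1 (by linarith) (by rw [sub_sub_cancel]; exact hd₂)
    have hJ₁ := hL.shiftedAction_le hξ₁c hr₁l (by linarith [hξ₂c.le]) hs₁
    have hJ₃ := hL.shiftedAction_le hξ₃c (by linarith [hξ₂c.le]) hr₂u hs₃
    rw [add_sub_cancel_left] at hJ₁
    rw [sub_sub_cancel] at hJ₃
    have j₂ : ξ₂ (r₂ - h) = ξ₃ (r₂ - h) := e₂.trans g₁.symm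
    have j₁ : ξ₁ (r₁ + h) = curveConcat ξ₂ ξ₃ (r₂ - h) (r₁ + h) := by
      rw [curveConcat_of_le hξ₂c.le, f₂, e₁]
    have h23 := hξ₂c.concat hξ₃c j₂
    refine ⟨curveConcat ξ₁ (curveConcat ξ₂ ξ₃ (r₂ - h)) (r₁ + h), hξ₁c.concat h23 j₁, ?_, ?_, ?_⟩
    · rw [curveConcat_of_le hξ₁c.le, f₁]
    · rw [curveConcat_of_ge j₁ h23.le, curveConcat_of_ge j₂ hξ₃c.le, g₂]
    · have hG2 : ENNReal.ofReal (G 2 * h) ≤ ENNReal.ofReal (|G 2| * h) :=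
        ENNReal.ofReal_le_ofReal (mul_le_mul_of_nonneg_right (le_abs_self _) hh.le)
      refine (shiftedAction_curveConcat_le hξ₁c.le h23.le j₁).trans ?_
      refine (add_le_add (hJ₁.trans hG2) ((shiftedAction_curveConcat_le hξ₂c.le hξ₃c.le j₂).trans
        (add_le_add (hJ₂.trans (add_le_add_left hηξ _)) (hJ₃.trans hG2)))).trans ?_
      rw [add_comm, add_assoc, add_assoc]
      refine add_le_add_right ?_ _
      rw [← ENNReal.ofReal_add (by positivity) (by positivity),
        ← ENNReal.ofReal_add (by positivity) (by positivity)]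
      refine ENNReal.ofReal_le_ofReal ?_
      have hdG : d * |G (4 * M)| ≤ 4 * h * |G (4 * M)| := by gcongr
      have hK₁h : 0 ≤ K₁ * h := by positivity
      have hK₂h : K₂ * h =
          6 * h * (α * M * T + B * T) + 4 * h * |G (4 * M)| + 2 * (|G 2| * h) := by
        rw [hK₂]; ring
      linarith

theorem action_eq (hL : Γ.LagrangianBounds H c T A α B ε G) (hH : Γ.IsHamiltonian H)
    (hc : Γ.IsFluxLimiter H c) {ξ : ℝ → EuclideanSpace ℝ (Fin N)} {a b : ℝ}
    (hξ : Γ.IsCurve ξ a b) (ha : 0 ≤ a) (hb : b ≤ T) :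
    Γ.action H c ξ a b = (Γ.shiftedAction H c A ξ a b : EReal) - ((A * (b - a) : ℝ) : EReal) :=
  hξ.action_add hH hc ha hL.A_nonneg fun τ hτ =>
    hL.add_nonneg (hξ.mem_support τ hτ) ⟨ha.trans hτ.1, hτ.2.trans hb⟩

theorem minAction_ne_top_and_ne_bot (hL : Γ.LagrangianBounds H c T A α B ε G)
    (hH : Γ.IsHamiltonian H) (hc : Γ.IsFluxLimiter H c) (hC : 0 < C)
    {x₁ x₂ : EuclideanSpace ℝ (Fin N)} {t₁ t₂ : ℝ} (h : (x₁, t₁, x₂, t₂) ∈ Γ.admissibleSet T C) :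
    Γ.minAction H c x₁ t₁ x₂ t₂ ≠ ⊤ ∧ Γ.minAction H c x₁ t₁ x₂ t₂ ≠ ⊥ := by
  constructor
  · obtain ⟨ξ, hξ, h1, h2, hJ⟩ := hL.exists_shiftedAction_le hC h
    refine ne_top_of_le_ne_top ?_ (iInf₂_le ξ ⟨hξ, h1, h2⟩)
    rw [hL.action_eq hH hc hξ h.2.1.1 h.2.2.2.1.2]
    have hJ' := ne_top_of_le_ne_top ENNReal.ofReal_ne_top hJ
    generalize Γ.shiftedAction H c A ξ t₁ t₂ = J at *
    lift J to NNReal using hJ'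
    rw [EReal.coe_nnreal_eq_coe_real, ← EReal.coe_sub]
    exact EReal.coe_ne_top _
  · refine ne_bot_of_le_ne_bot (EReal.coe_ne_bot (-(A * (t₂ - t₁)))) (le_iInf₂ fun ξ hξ => ?_)
    rw [hL.action_eq hH hc hξ.1 h.2.1.1 h.2.2.2.1.2, EReal.coe_neg,
      sub_eq_add_neg (_ : EReal)]
    exact le_add_of_nonneg_left (EReal.coe_ennreal_nonneg _)

theorem exists_minAction_le_add (hL : Γ.LagrangianBounds H c T A α B ε G)
    (hH : Γ.IsHamiltonian H) (hc : Γ.IsFluxLimiter H c) (hT : 0 < T) (hC : 0 < C) :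
    ∃ K, 0 ≤ K ∧ ∀ x₁ t₁ x₂ t₂ y₁ r₁ y₂ r₂ h, (x₁, t₁, x₂, t₂) ∈ Γ.admissibleSet T C →
      (y₁, r₁, y₂, r₂) ∈ Γ.admissibleSet T C → 0 < h →
      (Γ.geodesicDist x₁ y₁ ≤ h ∨ Γ.geodesicDist y₁ x₁ ≤ h) →
      (Γ.geodesicDist x₂ y₂ ≤ h ∨ Γ.geodesicDist y₂ x₂ ≤ h) →
      |t₁ - r₁| ≤ h → |t₂ - r₂| ≤ h →
      (Γ.minAction H c y₁ r₁ y₂ r₂).toReal ≤ (Γ.minAction H c x₁ t₁ x₂ t₂).toReal + K * h := by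
  obtain ⟨K, hK, key⟩ := hL.exists_perturbed hH hc hT hC
  have hA := hL.A_nonneg
  -- Undoing the shift subtracts `A` times the durations, which differ by at most `2 h`.
  refine ⟨K + 2 * A, by positivity, ?_⟩
  intro x₁ t₁ x₂ t₂ y₁ r₁ y₂ r₂ h hp hp' hh hd₁ hd₂ ht₁ ht₂
  obtain ⟨hp1, hp2⟩ := hL.minAction_ne_top_and_ne_bot hH hc hC hp
  obtain ⟨hp1', hp2'⟩ := hL.minAction_ne_top_and_ne_bot hH hc hC hp'
  obtain ⟨m', hm'⟩ : ∃ m' : ℝ, m' = (Γ.minAction H c y₁ r₁ y₂ r₂).toReal := ⟨_, rfl⟩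
  have hcoe' : (m' : EReal) = Γ.minAction H c y₁ r₁ y₂ r₂ := by
    rw [hm', EReal.coe_toReal hp1' hp2']
  have hmain : ((m' - (K + 2 * A) * h : ℝ) : EReal) ≤ Γ.minAction H c x₁ t₁ x₂ t₂ := by
    refine le_iInf₂ fun ξ hξ => ?_
    obtain ⟨ζ, hζ, e₁, e₂, hJ⟩ :=
      key x₁ t₁ x₂ t₂ y₁ r₁ y₂ r₂ h hp hp' hh hd₁ hd₂ ht₁ ht₂ ξ hξ.1 hξ.2.1 hξ.2.2
    have hle : (m' : EReal) ≤ Γ.action H c ζ r₁ r₂ := hcoe' ▸ iInf₂_le ζ ⟨hζ, e₁, e₂⟩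
    rw [hL.action_eq hH hc hζ hp'.2.1.1 hp'.2.2.2.1.2] at hle
    rw [hL.action_eq hH hc hξ.1 hp.2.1.1 hp.2.2.2.1.2]
    generalize Γ.shiftedAction H c A ξ t₁ t₂ = J at *
    generalize Γ.shiftedAction H c A ζ r₁ r₂ = J' at *
    by_cases hJt : J = ⊤
    · rw [hJt, EReal.coe_ennreal_top, EReal.top_sub_coe]
      exact le_top
    · have hJt' : J' ≠ ⊤ := ne_top_of_le_ne_top
        (ENNReal.add_ne_top.2 ⟨hJt, ENNReal.ofReal_ne_top⟩) hJ
      lift J to NNReal using hJt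
      lift J' to NNReal using hJt'
      rw [EReal.coe_nnreal_eq_coe_real, ← EReal.coe_sub, EReal.coe_le_coe_iff] at hle ⊢
      have hJr : (J' : ℝ) ≤ J + K * h := by
        have hKh : 0 ≤ K * h := by positivity
        have := ENNReal.toReal_mono (ENNReal.add_ne_top.2
          ⟨ENNReal.coe_ne_top, ENNReal.ofReal_ne_top⟩) hJ
        rwa [ENNReal.toReal_add ENNReal.coe_ne_top ENNReal.ofReal_ne_top,
          ENNReal.toReal_ofReal hKh, ENNReal.coe_toReal, ENNReal.coe_toReal] at this
      have hlen : A * (t₂ - t₁) ≤ A * (r₂ - r₁ + 2 * h) :=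
        mul_le_mul_of_nonneg_left (by linarith [(abs_le.1 ht₁).1, (abs_le.1 ht₂).2]) hA
      linarith
  rw [← EReal.coe_toReal hp1 hp2, EReal.coe_le_coe_iff] at hmain
  linarith

end LagrangianBounds

end EmbeddedNetwork

end

theorem mainTheorem6 {N : ℕ} {ι : Type*} (Γ : EmbeddedNetwork N ι)
    (H : ι → ℝ → ℝ → ℝ → ℝ) (hH : Γ.IsHamiltonian H)
    (c : EuclideanSpace ℝ (Fin N) → ℝ → ℝ) (hc : Γ.IsFluxLimiter H c)
    (T C : ℝ) (hT : 0 < T) (hC : 0 < C) :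
    (∀ x₁ t₁ x₂ t₂, (x₁, t₁, x₂, t₂) ∈ Γ.admissibleSet T C →
      Γ.minAction H c x₁ t₁ x₂ t₂ ≠ ⊤ ∧ Γ.minAction H c x₁ t₁ x₂ t₂ ≠ ⊥) ∧
    ∃ K : ℝ, ∀ x₁ t₁ x₂ t₂ y₁ r₁ y₂ r₂,
      (x₁, t₁, x₂, t₂) ∈ Γ.admissibleSet T C → (y₁, r₁, y₂, r₂) ∈ Γ.admissibleSet T C →
      |(Γ.minAction H c x₁ t₁ x₂ t₂).toReal - (Γ.minAction H c y₁ r₁ y₂ r₂).toReal| ≤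
        K * (Γ.geodesicDist x₁ y₁ + |t₁ - r₁| + Γ.geodesicDist x₂ y₂ + |t₂ - r₂|) := by
  obtain ⟨A, α, B, ε, G, hL⟩ := EmbeddedNetwork.exists_lagrangianBounds hH hc hT
  refine ⟨fun x₁ t₁ x₂ t₂ h => hL.minAction_ne_top_and_ne_bot hH hc hC h, ?_⟩
  obtain ⟨K, hK, key⟩ := hL.exists_minAction_le_add hH hc hT hC
  refine ⟨K, fun x₁ t₁ x₂ t₂ y₁ r₁ y₂ r₂ hp hp' => le_of_forall_pos_le_add fun η hη => ?_⟩
  have h1 := Γ.geodesicDist_nonneg x₁ y₁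
  have h2 := Γ.geodesicDist_nonneg x₂ y₂
  have h3 := abs_nonneg (t₁ - r₁)
  have h4 := abs_nonneg (t₂ - r₂)
  generalize hD : Γ.geodesicDist x₁ y₁ + |t₁ - r₁| + Γ.geodesicDist x₂ y₂ + |t₂ - r₂| = D
  have hη' : 0 < η / (K + 1) := by positivity
  have hKη : K * (η / (K + 1)) ≤ η := by
    rw [mul_div_assoc', div_le_iff₀ (by positivity)]
    nlinarith
  -- The margin `η / (K + 1)` keeps `h` positive even when `D = 0`, and costs at most `η`.
  have e1 := key x₁ t₁ x₂ t₂ y₁ r₁ y₂ r₂ (D + η / (K + 1)) hp hp' (by linarith)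
    (Or.inl (by linarith)) (Or.inl (by linarith)) (by linarith) (by linarith)
  have e2 := key y₁ r₁ y₂ r₂ x₁ t₁ x₂ t₂ (D + η / (K + 1)) hp' hp (by linarith)
    (Or.inr (by linarith)) (Or.inr (by linarith)) (by rw [abs_sub_comm]; linarith)
    (by rw [abs_sub_comm]; linarith)
  rw [abs_le]
  constructor <;> linarith
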